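/- Let $X_1,X_2,\dots$ be independent real random variables with a common probability density $\phi$ in the Schwartz class. For $p,q\in\mathbb N=\{1,2,\dots\}$ put $S_p=X_1+\dots+X_p$ and $T_{p+q}=\max(0,S_1,\dots,S_{p+q})$. For $j\ge1$ and $x_1,\dots,x_j\in\mathbb C$ put $$\Phi_j[z^m](x_1,\dots,x_j)=\sum_{\substack{l_1,\dots,l_j\ge1\\ l_1+\dots+l_j=m}}\frac{x_1^{l_1}}{l_1}\cdots\frac{x_j^{l_j}}{l_j}\qquad(m\ge1)$$ (so that $\Phi_j[z^m]=0$ for $m<j$), and extend this linearly to power series without constant term, $\Phi_j\big[\sum_{m\ge1}c_mz^m\big]=\sum_{m\ge1}c_m\Phi_j[z^m]$, wherever the latter series converges. With $(x)_+=\max(0,x)$ and $-(x)_-=\min(0,x)$ put $$\Omega_{j,k}(y_1,\dots,y_j,z_1,\dots,z_k)=\sum_{i=1}^j(y_i)_++\Big(-\sum_{i=1}^j(y_i)_-+\sum_{i=1}^k(z_i)_+\Big)_+ .$$ Let $\hat\phi(\eta)=\int_{\mathbb R}e^{-i\eta y}\phi(y)\,dy$, and let $$\mathcal F^{-1}[g](y,z)=(2\pi)^{-(j+k)}\int_{\mathbb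 R^j\times\mathbb R^k}e^{i(y\cdot\eta+z\cdot\zeta)}g(\eta,\zeta)\,d\eta\,d\zeta$$ be the inverse Fourier transform in $j+k$ variables. Then for all $a,b\in\mathbb C$ with $|a|,|b|<1$ and all $\alpha,\beta\in\mathbb R$, $$\sum_{p,q=1}^\infty a^pb^q\,\mathbb E\big[e^{i\alpha S_p+i\beta T_{p+q}}\big]=\sum_{j,k=1}^\infty\frac1{j!\,k!}\int_{\mathbb R^j\times\mathbb R^k}e^{i\alpha(y_1+\dots+y_j)+i\beta\Omega_{j,k}(y,z)}\,\mathcal F^{-1}\Big[\Phi_j\Big[\tfrac{as}{1-as}\Big]\big(\hat\phi(\eta_1),\dots,\hat\phi(\eta_j)\big)\,\Phi_k\Big[\tfrac{bt}{1-bt}\Big]\big(\hat\phi(\zeta_1),\dots,\hat\phi(\zeta_k)\big)\Big](y,z)\,dy\,dz,$$ where $\Phi_j$ and $\Phi_k$ act on functions of $s$ and $t$, respectively, and all the series and integrals (those defining $\Phi_j$, $\Phi_k$ and $\mathcal F^{-1}$ included) converge absolutely. -/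

import Mathlib

open MeasureTheory ProbabilityTheory
open scoped SchwartzMap

namespace WalkMax

noncomputable section

/-- The position `S_p = X_1 + ⋯ + X_p` of the walk; the step `X_{i+1}` is stored as `X i`. -/
def position {Ω : Type*} (X : ℕ → Ω → ℝ) (p : ℕ) (ω : Ω) : ℝ :=
  ∑ i ∈ Finset.range p, X i ω

/-- The running maximum `T_n = max (0, S_1, …, S_n)` (note `S_0 = 0`). -/
def runningMax {Ω : Type*} (X : ℕ → Ω → ℝ) (n : ℕ) (ω : Ω) : ℝ :=
  (Finset.range (n + 1)).sup' Finset.nonempty_range_add_one (fun k => position X k ω)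

/-- `Φ_j[z^m](x_1, …, x_j) = ∑_{l_1, …, l_j ≥ 1, l_1 + ⋯ + l_j = m} ∏_i x_i^{l_i} / l_i`,
which is an empty sum for `m < j`. -/
def phiMonomial (j m : ℕ) (x : Fin j → ℂ) : ℂ :=
  ∑ l ∈ (Finset.piAntidiag (Finset.univ : Finset (Fin j)) m).filter (fun l => ∀ i, 1 ≤ l i),
    ∏ i, x i ^ l i / (l i : ℂ)

/-- The `m`-th Taylor coefficient of `f` at the origin. -/
def taylorCoeff (f : ℂ → ℂ) (m : ℕ) : ℂ :=
  iteratedDeriv m f 0 / (m.factorial : ℂ)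

/-- The `j`-map `Φ_j`, extended linearly from the monomials along the Taylor series
`f(z) = ∑ c_m z^m` of a function analytic at the origin with `f(0) = 0`. -/
def Phi (j : ℕ) (f : ℂ → ℂ) (x : Fin j → ℂ) : ℂ :=
  ∑' m : ℕ, taylorCoeff f m * phiMonomial j m x

/-- The function `s ↦ a s / (1 - a s)`. -/
def geom (a : ℂ) : ℂ → ℂ := fun s => a * s / (1 - a * s)

/-- The piecewise linear weight `Ω_{j,k}`; here `(x)_+ = max 0 x` and `-(x)_- = min 0 x`. -/
def weight {j k : ℕ} (y : Fin j → ℝ) (z : Fin k → ℝ) : ℝ :=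
  ∑ i, max 0 (y i) + max 0 (∑ i, min 0 (y i) + ∑ i, max 0 (z i))

/-- `φ̂(η) = ∫ e^{-iηy} φ(y) dy`. -/
def hat (φ : ℝ → ℝ) (η : ℝ) : ℂ :=
  ∫ y : ℝ, Complex.exp (-(Complex.I * η * y)) * (φ y : ℂ)

/-- The inverse Fourier transform in all `j + k` variables,
`(2π)^{-(j+k)} ∫∫ e^{i(y·η + z·ζ)} g(η, ζ) dη dζ`. -/
def invFourier {j k : ℕ} (g : (Fin j → ℝ) × (Fin k → ℝ) → ℂ) (y : Fin j → ℝ) (z : Fin k → ℝ) : ℂ :=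
  (((2 * Real.pi) ^ (j + k))⁻¹ : ℝ) *
    ∫ v : (Fin j → ℝ) × (Fin k → ℝ),
      Complex.exp (Complex.I * ((∑ i, y i * v.1 i + ∑ i, z i * v.2 i : ℝ) : ℂ)) * g v

/-- The function of `(η, ζ)` to which the inverse Fourier transform is applied. -/
def symbol (φ : ℝ → ℝ) (a b : ℂ) (j k : ℕ) (v : (Fin j → ℝ) × (Fin k → ℝ)) : ℂ :=
  Phi j (geom a) (fun i => hat φ (v.1 i)) * Phi k (geom b) (fun i => hat φ (v.2 i))

/-- The integrand of the `(j, k)`-th term, as a function of `(y, z)`. -/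
def integrand (φ : ℝ → ℝ) (a b : ℂ) (α β : ℝ) (j k : ℕ) (w : (Fin j → ℝ) × (Fin k → ℝ)) : ℂ :=
  Complex.exp (Complex.I * ((α * ∑ i, w.1 i + β * weight w.1 w.2 : ℝ) : ℂ)) *
    invFourier (symbol φ a b j k) w.1 w.2

end

end WalkMax

/-!
Spitzer's identity, in the form it takes in a Rota–Baxter algebra, writes the generating series of
the laws of `(S_n, T_n)` as the exponential of `∑ μ_n Xⁿ / n`, where `μ_n` is the law of
`(S_n, max 0 S_n)`. Since `T_{p+q} = max T_p (S_p + T'_q)` with `T'_q` the running maximum of the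
`q` steps after time `p`, the expectation of `exp (iα S_p + iβ T_{p+q})` is an integral against
the product of two such laws, and expanding both exponentials gives the factors `1 / (j! k!)` and
the weight `Ω_{j,k}`. Evaluated at `X = a`, the measure `∑ aⁿ ρⁿ / n` built from the convolution
powers of the law `ρ` of a step has the inverse Fourier transform of `-log (1 - a φ̂)` as density,
and `Φ_j[as / (1 - as)]` is the product over `i` of `-log (1 - a x_i)`. Absolute convergence allows
the sums over the powers `j, k` and the times `p, q` to be exchanged.
-/

namespace WalkMax

noncomputable section

section RotaBaxter

variable {R : Type*} [CommSemiring R]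

/-- Rota–Baxter operators of weight `-1`. The usual identity
`P m * P n = P (P m * n) + P (m * P n) - P (m * n)` is rearranged so that no subtraction occurs. -/
def IsRotaBaxter (P : R →+ R) : Prop :=
  ∀ m n, P m * P n + P (m * n) = P (P m * n) + P (m * P n)

open Finset

-- Each use of the Rota–Baxter identity moves one factor `x` from the iterate into the power of `x`.
theorem IsRotaBaxter.telescope {P : R →+ R} (hP : IsRotaBaxter P) {x : R} {Q : ℕ → R}
    (hQ : ∀ n, Q (n + 1) = P (x * Q n)) {n i : ℕ} (hi : i ≤ n) :
    ∑ k ∈ range i, P (x ^ (k + 1)) * Q (n - k) + P (x ^ (i + 1) * Q (n - i)) =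
      P (x * ∑ k ∈ range i, P (x ^ (k + 1)) * Q (n - 1 - k)) + Q (n + 1) := by
  induction i with
  | zero => simp [hQ]
  | succ i ih =>
    obtain ⟨d, rfl⟩ : ∃ d, n = d + (i + 1) := ⟨n - (i + 1), by lia⟩
    have baxter := hP (x ^ (i + 1)) (x * Q d)
    rw [← hQ] at baxter
    have hQd : d + (i + 1) - i = d + 1 := by lia
    have hQd' : d + (i + 1) - 1 - i = d := by lia
    rw [hQd] at ih
    rw [sum_range_succ, sum_range_succ, hQd, hQd', Nat.add_sub_cancel, add_assoc,
      show x ^ (i + 1 + 1) * Q d = x ^ (i + 1) * (x * Q d) by ring, baxter, mul_add, map_add,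
      add_left_comm, ih (by lia),
      show P (x ^ (i + 1)) * (x * Q d) = x * (P (x ^ (i + 1)) * Q d) by ring]
    abel

theorem IsRotaBaxter.nsmul_succ {P : R →+ R} (hP : IsRotaBaxter P) {x : R} {Q : ℕ → R}
    (hQ0 : Q 0 = 1) (hQ : ∀ n, Q (n + 1) = P (x * Q n)) (n : ℕ) :
    (n + 1) • Q (n + 1) = ∑ k ∈ range (n + 1), P (x ^ (k + 1)) * Q (n - k) := by
  induction n with
  | zero => simp [hQ0, hQ]
  | succ n ih =>
    have h := hP.telescope hQ (le_refl (n + 1))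
    simp only [Nat.sub_self, hQ0, mul_one, add_tsub_cancel_right, ← ih] at h
    rw [sum_range_succ, Nat.sub_self, hQ0, mul_one, h, mul_smul_comm, map_nsmul, ← hQ,
      succ_nsmul _ (n + 1)]

end RotaBaxter

section Exponential

open Finset PowerSeries

variable {R : Type*} [CommSemiring R]

theorem coeff_pow_of_lt {f : R⟦X⟧} (hf : constantCoeff f = 0) {j n : ℕ} (h : n < j) :
    coeff n (f ^ j) = 0 :=
  coeff_of_lt_order _ ((Nat.cast_lt.2 h).trans_le (le_order_pow_of_constantCoeff_eq_zero j hf))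

theorem nsmul_coeff_pow (f : R⟦X⟧) (n j : ℕ) :
    (n + 1) • coeff (n + 1) (f ^ (j + 1)) =
      (j + 1) • ∑ k ∈ range (n + 1), ((k + 1) • coeff (k + 1) f) * coeff (n - k) (f ^ j) := by
  have coeff_deriv (g : R⟦X⟧) (i : ℕ) : (i + 1) • coeff (i + 1) g = coeff i (d⁄dX R g) := by
    rw [coeff_derivative, nsmul_eq_mul, mul_comm, Nat.cast_succ]
  simp_rw [coeff_deriv, ← Nat.sum_antidiagonal_eq_sum_range_succ
    (fun k l => coeff k (d⁄dX R f) * coeff l (f ^ j)), ← coeff_mul, ← map_nsmul]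
  rw [derivative_pow, Nat.add_sub_cancel, nsmul_eq_mul]
  congr 1
  ring

variable (𝕜 : Type*) [Semifield 𝕜] [Algebra 𝕜 R]

/-- The `n`-th coefficient of `exp f` for a power series `f` without constant term. -/
def expCoeff (f : R⟦X⟧) (n : ℕ) : R :=
  ∑ j ∈ range (n + 1), ((j.factorial : 𝕜)⁻¹) • coeff n (f ^ j)

theorem expCoeff_eq_sum_range {f : R⟦X⟧} (hf : constantCoeff f = 0) {n N : ℕ} (h : n < N) :
    expCoeff 𝕜 f n = ∑ j ∈ range N, ((j.factorial : 𝕜)⁻¹) • coeff n (f ^ j) := by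
  refine sum_subset (range_subset_range.2 h) fun j _ hj => ?_
  rw [coeff_pow_of_lt hf (by simpa using hj), smul_zero]

variable [CharZero 𝕜]

theorem nsmul_expCoeff_succ {f : R⟦X⟧} (hf : constantCoeff f = 0) (n : ℕ) :
    (n + 1) • expCoeff 𝕜 f (n + 1) =
      ∑ k ∈ range (n + 1), ((k + 1) • coeff (k + 1) f) * expCoeff 𝕜 f (n - k) := by
  have factorial_inv (j : ℕ) : ((j + 1).factorial : 𝕜)⁻¹ * (j + 1 : ℕ) = (j.factorial : 𝕜)⁻¹ := by
    rw [Nat.factorial_succ, Nat.cast_mul, mul_inv_rev, inv_mul_cancel_right₀]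
    exact Nat.cast_ne_zero.2 j.succ_ne_zero
  have hj (j : ℕ) : (n + 1) • (((j + 1).factorial : 𝕜)⁻¹ • coeff (n + 1) (f ^ (j + 1))) =
      ∑ k ∈ range (n + 1), ((k + 1) • coeff (k + 1) f) *
        ((j.factorial : 𝕜)⁻¹ • coeff (n - k) (f ^ j)) := by
    rw [smul_comm, nsmul_coeff_pow, ← Nat.cast_smul_eq_nsmul 𝕜, smul_smul, factorial_inv, smul_sum]
    simp_rw [mul_smul_comm]
  have h0 : coeff (n + 1) (f ^ 0) = 0 := by rw [pow_zero, coeff_one, if_neg n.succ_ne_zero]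
  rw [expCoeff, sum_range_succ', h0, smul_zero, add_zero, smul_sum, sum_congr rfl fun j _ => hj j,
    sum_comm]
  refine sum_congr rfl fun k _ => ?_
  rw [expCoeff_eq_sum_range 𝕜 hf (Nat.lt_succ_of_le (n.sub_le k)), mul_sum]

theorem eq_expCoeff_of_nsmul_succ {C Q : ℕ → R} (hQ0 : Q 0 = 1)
    (hQ : ∀ n, (n + 1) • Q (n + 1) = ∑ k ∈ range (n + 1), C (k + 1) * Q (n - k)) (n : ℕ) :
    Q n = expCoeff 𝕜 (PowerSeries.mk fun n => (n : 𝕜)⁻¹ • C n) n := by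
  have inv_smul_succ (n : ℕ) (x : R) : ((n + 1 : ℕ) : 𝕜)⁻¹ • ((n + 1) • x) = x := by
    rw [← Nat.cast_smul_eq_nsmul 𝕜, inv_smul_smul₀ (Nat.cast_ne_zero.2 n.succ_ne_zero)]
  induction n using Nat.strong_induction_on with
  | _ n ih =>
    cases n with
    | zero => simp [expCoeff, hQ0]
    | succ n =>
      rw [← inv_smul_succ n (Q (n + 1)), hQ, ← inv_smul_succ n (expCoeff _ _ (n + 1)),
        nsmul_expCoeff_succ 𝕜 (by simp)]
      congr 1
      refine sum_congr rfl fun k _ => ?_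
      rw [← ih _ (by lia), coeff_mk, smul_comm, inv_smul_succ]

/-- **Spitzer's identity** in its algebraic form. -/
theorem IsRotaBaxter.eq_expCoeff {P : R →+ R} (hP : IsRotaBaxter P) {x : R} {Q : ℕ → R}
    (hQ0 : Q 0 = 1) (hQ : ∀ n, Q (n + 1) = P (x * Q n)) (n : ℕ) :
    Q n = expCoeff 𝕜 (PowerSeries.mk fun n => (n : 𝕜)⁻¹ • P (x ^ n)) n :=
  eq_expCoeff_of_nsmul_succ 𝕜 hQ0 (hP.nsmul_succ hQ0 hQ) n

end Exponential

section Convolution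

open FiniteMeasure
open scoped NNReal

variable {E F : Type*} [AddCommMonoid E] [MeasurableSpace E] [MeasurableAdd₂ E]
  [AddCommMonoid F] [MeasurableSpace F] [MeasurableAdd₂ F]

/-- Finite measures on a commutative monoid form a commutative semiring whose product is the
convolution. -/
instance : CommSemiring (FiniteMeasure E) where
  mul m n := ⟨(m : Measure E).conv n, inferInstance⟩
  one := ⟨Measure.dirac 0, inferInstance⟩
  left_distrib _ _ _ := toMeasure_injective (Measure.conv_add _ _ _)
  right_distrib _ _ _ := toMeasure_injective (Measure.add_conv _ _ _)
  zero_mul _ := toMeasure_injective (Measure.zero_conv _)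
  mul_zero _ := toMeasure_injective (Measure.conv_zero _)
  mul_assoc _ _ _ := toMeasure_injective (Measure.conv_assoc _ _ _)
  one_mul _ := toMeasure_injective (Measure.dirac_zero_conv _)
  mul_one _ := toMeasure_injective (Measure.conv_dirac_zero _)
  mul_comm _ _ := toMeasure_injective (Measure.conv_comm _ _)

theorem toMeasure_mul (m n : FiniteMeasure E) :
    ((m * n : FiniteMeasure E) : Measure E) = (m : Measure E).conv n := rfl

theorem toMeasure_one : ((1 : FiniteMeasure E) : Measure E) = Measure.dirac 0 := rfl

theorem mul_eq_map_prod (m n : FiniteMeasure E) :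
    m * n = (m.prod n).map fun e => e.1 + e.2 := rfl

instance : Algebra ℝ≥0 (FiniteMeasure E) :=
  have smul_mul (c : ℝ≥0) (m n : FiniteMeasure E) : (c • m) * n = c • (m * n) :=
    toMeasure_injective (by
      rw [toMeasure_mul, toMeasure_smul, toMeasure_smul, toMeasure_mul]
      exact Measure.conv_smul_left _ _ (c : ENNReal))
  Algebra.ofModule smul_mul fun c m n => by rw [mul_comm, smul_mul, mul_comm]

theorem mass_map {A B : Type*} [MeasurableSpace A] [MeasurableSpace B] {f : A → B}
    (hf : Measurable f) (m : FiniteMeasure A) : (m.map f).mass = m.mass :=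
  map_apply_of_aemeasurable m hf.aemeasurable .univ

/-- The total mass, as a homomorphism from the convolution algebra. -/
def massHom : FiniteMeasure E →ₐ[ℝ≥0] ℝ≥0 :=
  AlgHom.ofLinearMap
    { toFun := mass
      map_add' := fun m n => congrFun (coeFn_add m n) _
      map_smul' := fun c m => congrFun (coeFn_smul c m) _ }
    (congrArg ENNReal.toNNReal measure_univ : (Measure.dirac (0 : E) Set.univ).toNNReal = 1)
    (fun m n => (mass_map measurable_add _).trans (mass_prod m n))

theorem massHom_apply (m : FiniteMeasure E) : massHom m = m.mass := rfl

theorem map_addMonoidHom_pow (L : E →+ F) (hL : Measurable L) (m : FiniteMeasure E) (n : ℕ) :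
    (m ^ n).map L = m.map L ^ n := by
  induction n with
  | zero => exact toMeasure_injective ((Measure.map_dirac' hL 0).trans (by rw [map_zero]; rfl))
  | succ n ih =>
    rw [pow_succ, pow_succ, ← ih]
    exact toMeasure_injective (Measure.map_conv_addMonoidHom L hL)

theorem lintegral_map_conv_map {u v w : E → E} (hu : Measurable u) (hv : Measurable v)
    (hw : Measurable w) (m n : FiniteMeasure E) {f : E → ENNReal} (hf : Measurable f) :
    ∫⁻ e, f e ∂((m.map u * n.map v).map w : FiniteMeasure E) =
      ∫⁻ x, ∫⁻ y, f (w (u x + v y)) ∂n ∂m := by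
  rw [toMeasure_map, lintegral_map hf hw, toMeasure_mul, Measure.lintegral_conv (by fun_prop),
    toMeasure_map, toMeasure_map, lintegral_map (by fun_prop) hu]
  exact lintegral_congr fun x => lintegral_map (by fun_prop) hv

theorem isRotaBaxter_mapHom {h : E → E} (hm : Measurable h)
    (hh : ∀ x y, s(h x + h y, h (x + y)) = s(h (h x + y), h (x + h y))) :
    IsRotaBaxter (mapHom hm : FiniteMeasure E →+ FiniteMeasure E) := by
  have lint {u v w : E → E} (hu : Measurable u) (hv : Measurable v) (hw : Measurable w) :=
    @lintegral_map_conv_map E _ _ _ u v w hu hv hw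
  have map_id (m : FiniteMeasure E) : m.map id = m := toMeasure_injective Measure.map_id
  intro m n
  refine toMeasure_injective (Measure.ext_of_lintegral _ fun f hf => ?_)
  have hu := lint hm hm measurable_id m n hf
  have hd := lint measurable_id measurable_id hm m n hf
  have hl := lint hm measurable_id hm m n hf
  have hr := lint measurable_id hm hm m n hf
  simp only [map_id, id] at hu hd hl hr
  change ∫⁻ e, f e ∂((m.map h * n.map h + (m * n).map h : FiniteMeasure E) : Measure E) =
    ∫⁻ e, f e ∂(((m.map h * n).map h + (m * n.map h).map h : FiniteMeasure E) : Measure E)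
  rw [toMeasure_add, toMeasure_add, lintegral_add_measure, lintegral_add_measure, hu, hd, hl, hr,
    ← lintegral_add_left (by fun_prop), ← lintegral_add_left (by fun_prop)]
  refine lintegral_congr fun x => ?_
  rw [← lintegral_add_left (by fun_prop), ← lintegral_add_left (by fun_prop)]
  refine lintegral_congr fun y => ?_
  rcases Sym2.eq_iff.1 (hh x y) with ⟨h₁, h₂⟩ | ⟨h₁, h₂⟩
  · rw [h₁, h₂]
  · rw [h₁, h₂, add_comm]

end Convolution

section Spitzer

open FiniteMeasure
open scoped NNReal

/-- The map `(s, t) ↦ (s, t⁺)`, whose push-forward is the Rota–Baxter operator behind Spitzer's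
identity for the maximum of a walk. -/
def posSnd (e : ℝ × ℝ) : ℝ × ℝ := (e.1, max 0 e.2)

theorem measurable_posSnd : Measurable posSnd := by
  unfold posSnd; fun_prop

theorem isRotaBaxter_posSnd :
    IsRotaBaxter (mapHom measurable_posSnd : FiniteMeasure (ℝ × ℝ) →+ FiniteMeasure (ℝ × ℝ)) := by
  refine isRotaBaxter_mapHom measurable_posSnd fun ⟨s, t⟩ ⟨s', t'⟩ => ?_
  simp only [posSnd, Prod.mk_add_mk, Sym2.eq_iff, Prod.mk.injEq, true_and]
  grind

/-- The diagonal embedding `y ↦ (y, y)` of the line into the plane. -/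
def diag : ℝ →+ ℝ × ℝ := (AddMonoidHom.id ℝ).prod (AddMonoidHom.id ℝ)

theorem measurable_diag : Measurable diag := measurable_id.prodMk measurable_id

/-- The law of `(S_n, T_n)` for a walk with step law `ρ`, obtained by adding one more step at the
beginning of the walk. -/
def walkLaw (ρ : FiniteMeasure ℝ) : ℕ → FiniteMeasure (ℝ × ℝ)
  | 0 => 1
  | n + 1 => (ρ.map diag * walkLaw ρ n).map posSnd

/-- The logarithm `∑ μ_n X ^ n / n` of the generating series of the laws of `(S_n, T_n)`, where
`μ_n` is the law of `(S_n, S_n⁺)`. -/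
def logSeries (ρ : FiniteMeasure ℝ) : PowerSeries (FiniteMeasure (ℝ × ℝ)) :=
  PowerSeries.mk fun n => (n : ℝ≥0)⁻¹ • (ρ ^ n).map fun y => (y, max 0 y)

theorem walkLaw_eq_expCoeff (ρ : FiniteMeasure ℝ) (n : ℕ) :
    walkLaw ρ n = expCoeff ℝ≥0 (logSeries ρ) n := by
  have posSnd_diag (n : ℕ) :
      (ρ.map diag ^ n).map posSnd = (ρ ^ n).map fun y => (y, max 0 y) := by
    rw [← map_addMonoidHom_pow diag measurable_diag]
    exact toMeasure_injective (Measure.map_map measurable_posSnd measurable_diag)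
  rw [logSeries]
  simp_rw [← posSnd_diag]
  exact isRotaBaxter_posSnd.eq_expCoeff ℝ≥0 (Q := walkLaw ρ) rfl (fun _ => rfl) n

theorem mass_walkLaw (ρ : FiniteMeasure ℝ) (n : ℕ) : (walkLaw ρ n).mass = ρ.mass ^ n := by
  induction n with
  | zero => exact map_one massHom
  | succ n ih =>
    rw [walkLaw, mass_map measurable_posSnd, ← massHom_apply, map_mul, massHom_apply,
      massHom_apply, mass_map measurable_diag, ih, pow_succ']

end Spitzer

section Walk

variable {Ω Ω' : Type*}

theorem position_congr {X : ℕ → Ω → ℝ} {Y : ℕ → Ω' → ℝ} {n : ℕ} {ω : Ω} {ω' : Ω'}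
    (h : ∀ i < n, X i ω = Y i ω') : position X n ω = position Y n ω' :=
  Finset.sum_congr rfl fun i hi => h i (Finset.mem_range.1 hi)

theorem position_add (X : ℕ → Ω → ℝ) (p q : ℕ) (ω : Ω) :
    position X (p + q) ω = position X p ω + position (fun i => X (p + i)) q ω :=
  Finset.sum_range_add _ p q

theorem runningMax_le_iff {X : ℕ → Ω → ℝ} {n : ℕ} {ω : Ω} {c : ℝ} :
    runningMax X n ω ≤ c ↔ ∀ k ≤ n, position X k ω ≤ c := by
  simp only [runningMax, Finset.sup'_le_iff, Finset.mem_range, Nat.lt_succ_iff]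

theorem runningMax_add (X : ℕ → Ω → ℝ) (p q : ℕ) (ω : Ω) :
    runningMax X (p + q) ω =
      max (runningMax X p ω) (position X p ω + runningMax (fun i => X (p + i)) q ω) := by
  refine eq_of_forall_ge_iff fun c => ?_
  rw [max_le_iff, ← le_sub_iff_add_le', runningMax_le_iff, runningMax_le_iff, runningMax_le_iff]
  simp_rw [le_sub_iff_add_le', ← position_add]
  refine ⟨fun h => ⟨fun k hk => h k (by lia), fun k hk => h (p + k) (by lia)⟩,
    fun ⟨hp, hq⟩ k hk => (le_total k p).elim (hp k) fun hpk => ?_⟩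
  obtain ⟨r, rfl⟩ := Nat.exists_eq_add_of_le hpk
  exact hq r (by lia)

/-- The pair `(S_n, T_n)`. -/
def walkState (X : ℕ → Ω → ℝ) (n : ℕ) (ω : Ω) : ℝ × ℝ :=
  (position X n ω, runningMax X n ω)

theorem walkState_congr {X : ℕ → Ω → ℝ} {Y : ℕ → Ω' → ℝ} {n : ℕ} {ω : Ω} {ω' : Ω'}
    (h : ∀ i < n, X i ω = Y i ω') : walkState X n ω = walkState Y n ω' := by
  refine Prod.ext (position_congr h) (Finset.sup'_congr Finset.nonempty_range_add_one rfl
    fun k hk => ?_)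
  exact position_congr fun i hi => h i (hi.trans_le (Finset.mem_range_succ_iff.1 hk))

theorem walkState_succ (X : ℕ → Ω → ℝ) (n : ℕ) (ω : Ω) :
    walkState X (n + 1) ω = posSnd (diag (X 0 ω) + walkState (fun i => X (1 + i)) n ω) := by
  have position_one : position X 1 ω = X 0 ω := by simp [position]
  have runningMax_one : runningMax X 1 ω = max 0 (X 0 ω) := by
    simp [runningMax, position, Finset.range_add_one, max_comm]
  have runningMax_nonneg : 0 ≤ runningMax (fun i => X (1 + i)) n ω :=
    runningMax_le_iff.1 le_rfl 0 n.zero_le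
  rw [walkState, add_comm n 1, position_add, runningMax_add, position_one, runningMax_one]
  simp only [walkState, posSnd, diag, AddMonoidHom.prod_apply, AddMonoidHom.id_apply,
    Prod.mk_add_mk, Prod.mk.injEq, true_and]
  grind

variable [MeasurableSpace Ω]

theorem measurable_walkState {X : ℕ → Ω → ℝ} (hX : ∀ i, Measurable (X i)) (n : ℕ) :
    Measurable (walkState X n) := by
  have measurable_position (k : ℕ) : Measurable (position X k) :=
    Finset.measurable_fun_sum _ fun i _ => hX i
  exact (measurable_position n).prodMk
    (Finset.measurable_range_sup'' fun k _ => measurable_position k)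

variable {μ : Measure Ω} {X : ℕ → Ω → ℝ}

theorem indepFun_walkState (hX : ∀ i, AEMeasurable (X i) μ) (hindep : iIndepFun X μ) (p q : ℕ) :
    IndepFun (walkState X p) (walkState (fun i => X (p + i)) q) μ := by
  classical
  let extend (s : Finset ℕ) (i : ℕ) (v : s → ℝ) : ℝ := if hi : i ∈ s then v ⟨i, hi⟩ else 0
  have measurable_extend (s : Finset ℕ) (i : ℕ) : Measurable (extend s i) := by
    by_cases hi : i ∈ s
    · simpa only [extend, hi, dif_pos] using measurable_pi_apply _
    · simpa only [extend, hi, dif_neg, not_false_iff] using measurable_const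
  have blocks : IndepFun (fun ω (i : Finset.range p) => X i ω)
      (fun ω (i : Finset.Ico p (p + q)) => X i ω) μ :=
    hindep.indepFun_finset₀ _ _
      (Finset.disjoint_left.2 fun i => by simp only [Finset.mem_range, Finset.mem_Ico]; lia) hX
  convert blocks.comp
    (measurable_walkState (fun i => measurable_extend (Finset.range p) i) p)
    (measurable_walkState (fun i => measurable_extend (Finset.Ico p (p + q)) (p + i)) q) using 1
  all_goals
    ext1 ω
    refine walkState_congr fun i hi => ?_
    simp [extend, hi]

theorem hasLaw_walkState {ρ : FiniteMeasure ℝ} (hX : ∀ i, HasLaw (X i) ρ μ)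
    (hindep : iIndepFun X μ) (n : ℕ) : HasLaw (walkState X n) (walkLaw ρ n) μ := by
  have := hindep.isProbabilityMeasure
  induction n generalizing X with
  | zero =>
    have walkState_zero : walkState X 0 = fun _ => 0 := by
      ext <;> simp [walkState, position, runningMax]
    rw [walkState_zero]
    exact ⟨aemeasurable_const, by simp [walkLaw, toMeasure_one]⟩
  | succ n ih =>
    have first : HasLaw (fun ω => diag (X 0 ω)) (ρ.map diag) μ :=
      HasLaw.fun_comp ⟨measurable_diag.aemeasurable, rfl⟩ (hX 0)
    have rest : HasLaw (walkState (fun i => X (1 + i)) n) (walkLaw ρ n) μ :=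
      ih (fun i => hX _) (hindep.precomp (add_right_injective 1))
    have indep : IndepFun (fun ω => diag (X 0 ω)) (walkState (fun i => X (1 + i)) n) μ := by
      convert (indepFun_walkState (fun i => (hX i).aemeasurable) hindep 1 n).comp
        (measurable_diag.comp measurable_fst) measurable_id using 1
      swap; · rfl
      ext1 ω
      simp [walkState, position]
    have := HasLaw.comp ⟨measurable_posSnd.aemeasurable, rfl⟩ (indep.hasLaw_add first rest)
    exact this.congr (.of_forall fun ω => walkState_succ X n ω)

end Walk

section MeasureSum

variable {ι ι' A A' E E' : Type*} [MeasurableSpace A] [MeasurableSpace A'] [MeasurableSpace E]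
  [MeasurableSpace E']

theorem integrable_of_norm_le {m : Measure E} [IsFiniteMeasure m] {F : E → ℂ} (hF : Measurable F)
    {C : ℝ} (hC : ∀ e, ‖F e‖ ≤ C) : Integrable F m :=
  .of_bound hF.aestronglyMeasurable C (.of_forall hC)

theorem norm_integral_le_mass {F : E → ℂ} {C : ℝ} (hC : ∀ e, ‖F e‖ ≤ C) (m : FiniteMeasure E) :
    ‖∫ e, F e ∂(m : Measure E)‖ ≤ C * m.mass :=
  norm_integral_le_of_norm_le_const (.of_forall hC)

theorem norm_mul_integral_le {F : E → ℂ} {C : ℝ} (hC : ∀ e, ‖F e‖ ≤ C) (c : ℂ)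
    (m : FiniteMeasure E) : ‖c * ∫ e, F e ∂(m : Measure E)‖ ≤ C * (‖c‖ * m.mass) := by
  rw [norm_mul, mul_left_comm]
  exact mul_le_mul_of_nonneg_left (norm_integral_le_mass hC m) (norm_nonneg c)

theorem summable_mul_integral {c : ι → ℂ} {m : ι → FiniteMeasure E}
    (hcm : Summable fun i => ‖c i‖ * (m i).mass) {F : E → ℂ} {C : ℝ} (hC : ∀ e, ‖F e‖ ≤ C) :
    Summable fun i => c i * ∫ e, F e ∂(m i : Measure E) :=
  (hcm.mul_left C).of_norm_bounded fun i => norm_mul_integral_le hC (c i) (m i)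

theorem summable_mass_prod {c : ι → ℂ} {c' : ι' → ℂ} {m : ι → FiniteMeasure E}
    {m' : ι' → FiniteMeasure E'} (h : Summable fun i => ‖c i‖ * (m i).mass)
    (h' : Summable fun i => ‖c' i‖ * (m' i).mass) :
    Summable fun i : ι × ι' => ‖c i.1 * c' i.2‖ * ((m i.1).prod (m' i.2)).mass := by
  refine (h.mul_of_nonneg h' (fun i => by positivity) fun i => by positivity).congr fun i => ?_
  rw [FiniteMeasure.mass_prod, norm_mul, NNReal.coe_mul]
  ring

theorem measurable_integral_mul {ν : Measure A} [SFinite ν] {H : E → A → ℂ}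
    (hH : Measurable (Function.uncurry H)) {g : A → ℂ} (hg : AEStronglyMeasurable g ν) :
    Measurable fun e => ∫ x, H e x * g x ∂ν := by
  have integral_mk (e : E) : ∫ x, H e x * g x ∂ν = ∫ x, H e x * hg.mk g x ∂ν :=
    integral_congr_ae (hg.ae_eq_mk.mono fun x hx => congrArg (H e x * ·) hx)
  simp_rw [integral_mk]
  have := hg.stronglyMeasurable_mk.measurable
  exact (show Measurable fun p : E × A => H p.1 p.2 * hg.mk g p.2 by
    fun_prop).stronglyMeasurable.integral_prod_right'.measurable

/-- The series `∑ c_i m_i` of multiples of finite measures converges absolutely, and its sum is the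
image under `T` of the complex measure with density `g` with respect to `ν`. The sum is described
through its integrals of bounded measurable functions. -/
structure HasMeasureSum (c : ι → ℂ) (m : ι → FiniteMeasure E) (ν : Measure A) (g : A → ℂ)
    (T : A → E) : Prop where
  summable_mass : Summable fun i => ‖c i‖ * (m i).mass
  integrable_density : Integrable g ν
  measurable_map : Measurable T
  hasSum_integral : ∀ ⦃F : E → ℂ⦄, Measurable F → ∀ ⦃C : ℝ⦄, (∀ e, ‖F e‖ ≤ C) →
    HasSum (fun i => c i * ∫ e, F e ∂(m i : Measure E)) (∫ x, F (T x) * g x ∂ν)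

variable {c : ι → ℂ} {c' : ι' → ℂ} {m : ι → FiniteMeasure E} {m' : ι' → FiniteMeasure E'}
  {ν : Measure A} {ν' : Measure A'} {g : A → ℂ} {g' : A' → ℂ} {T : A → E} {T' : A' → E'}

namespace HasMeasureSum

theorem integrable_comp_mul (h : HasMeasureSum c m ν g T) {F : E → ℂ} (hF : Measurable F) {C : ℝ}
    (hC : ∀ e, ‖F e‖ ≤ C) : Integrable (fun x => F (T x) * g x) ν :=
  h.integrable_density.bdd_mul (hF.comp h.measurable_map).aestronglyMeasurable
    (.of_forall fun x => hC (T x))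

theorem congr_density (h : HasMeasureSum c m ν g T) {f : A → ℂ} (hf : f =ᵐ[ν] g) :
    HasMeasureSum c m ν f T where
  summable_mass := h.summable_mass
  integrable_density := h.integrable_density.congr hf.symm
  measurable_map := h.measurable_map
  hasSum_integral F hF C hC := by
    rw [integral_congr_ae (hf.mono fun x hx => congrArg (F (T x) * ·) hx)]
    exact h.hasSum_integral hF hC

theorem map (h : HasMeasureSum c m ν g T) {S : E → E'} (hS : Measurable S) :
    HasMeasureSum c (fun i => (m i).map S) ν g (fun x => S (T x)) where
  summable_mass := by simpa only [mass_map hS] using h.summable_mass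
  integrable_density := h.integrable_density
  measurable_map := hS.comp h.measurable_map
  hasSum_integral F hF C hC := by
    simp only [FiniteMeasure.toMeasure_map,
      integral_map hS.aemeasurable hF.aestronglyMeasurable]
    exact h.hasSum_integral (hF.comp hS) fun e => hC (S e)

theorem comp_measurePreserving (h : HasMeasureSum c m ν g T) (e : A' ≃ᵐ A)
    (he : MeasurePreserving e ν' ν) :
    HasMeasureSum c m ν' (fun x => g (e x)) (fun x => T (e x)) where
  summable_mass := h.summable_mass
  integrable_density := he.integrable_comp_of_integrable h.integrable_density
  measurable_map := h.measurable_map.comp e.measurable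
  hasSum_integral F hF C hC := by
    rw [he.integral_comp' fun x => F (T x) * g x]
    exact h.hasSum_integral hF hC

theorem comp_injective (h : HasMeasureSum c m ν g T) {e : ι' → ι} (he : Function.Injective e)
    (hm : ∀ i ∉ Set.range e, m i = 0) :
    HasMeasureSum (fun i => c (e i)) (fun i => m (e i)) ν g T where
  summable_mass := h.summable_mass.comp_injective he
  integrable_density := h.integrable_density
  measurable_map := h.measurable_map
  hasSum_integral F hF C hC :=
    (he.hasSum_iff fun i hi => by simp [hm i hi]).2 (h.hasSum_integral hF hC)

theorem sum_fiber {κ : ι → Type*} [∀ i, Fintype (κ i)] {m : (Σ i, κ i) → FiniteMeasure E}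
    (h : HasMeasureSum (fun s : Σ i, κ i => c s.1) m ν g T) :
    HasMeasureSum c (fun i => ∑ k, m ⟨i, k⟩) ν g T where
  summable_mass := by
    refine h.summable_mass.sigma.congr fun i => ?_
    simp only [tsum_fintype, ← Finset.mul_sum, ← NNReal.coe_sum]
    simp only [FiniteMeasure.mass, FiniteMeasure.coeFn_def, FiniteMeasure.toMeasure_sum,
      Measure.coe_finsetSum, Finset.sum_apply]
    rw [ENNReal.toNNReal_sum fun k _ => measure_ne_top _ _]
  integrable_density := h.integrable_density
  measurable_map := h.measurable_map
  hasSum_integral F hF C hC := by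
    refine ((h.hasSum_integral hF hC).sigma fun i => hasSum_fintype _).congr_fun fun i => ?_
    rw [FiniteMeasure.toMeasure_sum,
      integral_finsetSum_measure fun k _ => integrable_of_norm_le hF hC, Finset.mul_sum]

theorem hasSum_integral_prod_right [Countable ι'] [SFinite ν'] (h' : HasMeasureSum c' m' ν' g' T')
    (m : FiniteMeasure E) {H : E × E' → ℂ} (hH : Measurable H) {C : ℝ} (hC : ∀ e, ‖H e‖ ≤ C) :
    HasSum (fun i => c' i * ∫ e, H e ∂(m.prod (m' i) : Measure (E × E')))
      (∫ e, ∫ x, H (e, T' x) * g' x ∂ν' ∂(m : Measure E)) := by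
  let f (i : ι') (e : E) : ℂ := c' i * ∫ e', H (e, e') ∂(m' i : Measure E')
  have norm_f (i : ι') (e : E) : ‖f i e‖ ≤ C * (‖c' i‖ * (m' i).mass) :=
    norm_mul_integral_le (fun e' => hC (e, e')) (c' i) (m' i)
  have integrable_f (i : ι') : Integrable (f i) (m : Measure E) :=
    integrable_of_norm_le (hH.stronglyMeasurable.integral_prod_right'.measurable.const_mul _)
      (norm_f i)
  have summable_f : Summable fun i => ∫ e, ‖f i e‖ ∂(m : Measure E) :=
    ((h'.summable_mass.mul_left C).mul_right _).of_nonneg_of_le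
      (fun i => integral_nonneg fun e => norm_nonneg _) fun i =>
        (integral_mono (integrable_f i).norm (integrable_const _) (norm_f i)).trans_eq
          ((integral_const _).trans (mul_comm _ _))
  have tsum_f (e : E) : ∑' i, f i e = ∫ x, H (e, T' x) * g' x ∂ν' :=
    (h'.hasSum_integral (F := fun e' => H (e, e')) (by fun_prop) fun e' => hC _).tsum_eq
  have := hasSum_integral_of_summable_integral_norm integrable_f summable_f
  simp_rw [tsum_f] at this
  refine this.congr_fun fun i => ?_
  rw [FiniteMeasure.toMeasure_prod, integral_prod _ (integrable_of_norm_le hH hC),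
    integral_const_mul]

theorem prod [Countable ι'] [SFinite ν] [SFinite ν'] (h : HasMeasureSum c m ν g T)
    (h' : HasMeasureSum c' m' ν' g' T') :
    HasMeasureSum (fun i : ι × ι' => c i.1 * c' i.2) (fun i => (m i.1).prod (m' i.2)) (ν.prod ν')
      (fun x => g x.1 * g' x.2) (fun x => (T x.1, T' x.2)) where
  summable_mass := summable_mass_prod h.summable_mass h'.summable_mass
  integrable_density := h.integrable_density.mul_prod h'.integrable_density
  measurable_map := (h.measurable_map.comp measurable_fst).prodMk
    (h'.measurable_map.comp measurable_snd)
  hasSum_integral H hH C hC := by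
    have := h.measurable_map
    have := h'.measurable_map
    let K (e : E) : ℂ := ∫ x, H (e, T' x) * g' x ∂ν'
    have measurable_K : Measurable K :=
      measurable_integral_mul (H := fun e x => H (e, T' x)) (by fun_prop)
        h'.integrable_density.aestronglyMeasurable
    have norm_K (e : E) : ‖K e‖ ≤ ∫ x, C * ‖g' x‖ ∂ν' := by
      refine norm_integral_le_of_norm_le (h'.integrable_density.norm.const_mul C)
        (.of_forall fun x => ?_)
      rw [norm_mul]
      exact mul_le_mul_of_nonneg_right (hC _) (norm_nonneg _)
    have summable_H : Summable fun i : ι × ι' =>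
        c i.1 * c' i.2 * ∫ e, H e ∂((m i.1).prod (m' i.2) : Measure (E × E')) :=
      summable_mul_integral (summable_mass_prod h.summable_mass h'.summable_mass) hC
    have fubini : ∫ x, K (T x) * g x ∂ν =
        ∫ x, H (T x.1, T' x.2) * (g x.1 * g' x.2) ∂(ν.prod ν') := by
      rw [integral_prod]
      · refine integral_congr_ae (.of_forall fun x => ?_)
        simp only [K, ← integral_mul_const]
        exact integral_congr_ae (.of_forall fun y => by ring)
      · exact (h.integrable_density.mul_prod h'.integrable_density).bdd_mul
          (show Measurable fun x : A × A' => H (T x.1, T' x.2) by fun_prop).aestronglyMeasurable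
          (.of_forall fun x => hC _)
    rw [← fubini]
    refine (h.hasSum_integral measurable_K norm_K).unique ?_ ▸ summable_H.hasSum
    refine summable_H.hasSum.prod_fiberwise fun i => ?_
    simpa only [mul_assoc] using (h'.hasSum_integral_prod_right (m i) hH hC).mul_left (c i)

end HasMeasureSum

end MeasureSum

section Density

open scoped ENNReal NNReal

variable {ι E : Type*} [Countable ι] [MeasurableSpace E] {ν : Measure E}

theorem integrable_tsum {f : ι → E → ℂ} (hf : ∀ i, Integrable (f i) ν)
    (hsum : Summable fun i => ∫ x, ‖f i x‖ ∂ν) : Integrable (fun x => ∑' i, f i x) ν := by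
  have lintegral_lt_top : ∫⁻ x, ∑' i, ‖f i x‖ₑ ∂ν < ∞ := by
    rw [lintegral_tsum fun i => (hf i).aestronglyMeasurable.enorm]
    simp_rw [← fun i => ofReal_integral_norm_eq_lintegral_enorm (hf i)]
    rw [← ENNReal.ofReal_tsum_of_nonneg (fun i => integral_nonneg fun _ => norm_nonneg _) hsum]
    exact ENNReal.ofReal_lt_top
  have summable_ae : ∀ᵐ x ∂ν, Summable fun i => f i x := by
    filter_upwards [ae_lt_top' (AEMeasurable.tsum fun i =>
      (hf i).aestronglyMeasurable.enorm) lintegral_lt_top.ne] with x hx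
    refine Summable.of_norm ?_
    simpa [enorm] using ENNReal.tsum_coe_ne_top_iff_summable_coe.1 hx.ne
  exact ⟨aestronglyMeasurable_of_tendsto_ae Filter.atTop
    (fun s => Finset.aestronglyMeasurable_fun_sum s fun i _ => (hf i).aestronglyMeasurable)
    (summable_ae.mono fun x hx => hx.hasSum),
    (lintegral_mono fun x => enorm_tsum_le_tsum_enorm).trans_lt lintegral_lt_top⟩

theorem exists_hasMeasureSum [SigmaFinite ν] {c : ι → ℂ} {m : ι → FiniteMeasure E}
    (hcm : Summable fun i => ‖c i‖ * (m i).mass) (hac : ∀ i, (m i : Measure E) ≪ ν) :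
    ∃ g, HasMeasureSum c m ν g id := by
  let f (i : ι) (x : E) : ℂ := c i * (((m i : Measure E).rnDeriv ν x).toReal : ℂ)
  have integrable_f (i : ι) : Integrable (f i) ν :=
    Measure.integrable_toReal_rnDeriv.ofReal.const_mul _
  have integral_norm_f (i : ι) : ∫ x, ‖f i x‖ ∂ν = ‖c i‖ * (m i).mass := by
    simp only [f, norm_mul, Complex.norm_real, Real.norm_of_nonneg ENNReal.toReal_nonneg,
      integral_const_mul, Measure.integral_toReal_rnDeriv (hac i)]
    rfl
  have summable_f : Summable fun i => ∫ x, ‖f i x‖ ∂ν := by simpa only [integral_norm_f]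
  refine ⟨fun x => ∑' i, f i x, hcm, integrable_tsum integrable_f summable_f, measurable_id,
    fun F hF C hC => ?_⟩
  have integrable_Ff (i : ι) : Integrable (fun x => F x * f i x) ν :=
    (integrable_f i).bdd_mul hF.aestronglyMeasurable (.of_forall hC)
  have summable_Ff : Summable fun i => ∫ x, ‖F x * f i x‖ ∂ν := by
    refine (summable_f.mul_left C).of_nonneg_of_le
      (fun i => integral_nonneg fun _ => norm_nonneg _) fun i => ?_
    rw [← integral_const_mul]
    refine integral_mono (integrable_Ff i).norm ((integrable_f i).norm.const_mul C) fun x => ?_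
    simpa only [norm_mul (F x)] using mul_le_mul_of_nonneg_right (hC x) (norm_nonneg _)
  have hasSum_Ff := hasSum_integral_of_summable_integral_norm integrable_Ff summable_Ff
  simp_rw [tsum_mul_left] at hasSum_Ff
  refine hasSum_Ff.congr_fun fun i => ?_
  rw [← integral_rnDeriv_smul (hac i), ← integral_const_mul]
  exact integral_congr_ae (.of_forall fun x => by simp only [f, Complex.real_smul]; ring)

end Density

section PowerSeries

open PowerSeries

variable {A A' E : Type*} [MeasurableSpace A] [MeasurableSpace A'] [MeasurableSpace E]
  [AddCommMonoid E] [MeasurableAdd₂ E] {a : ℂ} {f f' : PowerSeries (FiniteMeasure E)}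
  {ν : Measure A} {ν' : Measure A'} [SFinite ν] [SFinite ν'] {g : A → ℂ} {g' : A' → ℂ}
  {T : A → E} {T' : A' → E}

namespace HasMeasureSum

theorem coeff_one (a : ℂ) :
    HasMeasureSum (fun n => a ^ n) (fun n => coeff n (1 : PowerSeries (FiniteMeasure E)))
      (volume : Measure (Fin 0 → ℝ)) (fun _ => 1) (fun _ => 0) where
  summable_mass := summable_of_ne_finset_zero (s := {0}) fun n hn => by
    rw [PowerSeries.coeff_one, if_neg (by simpa using hn)]
    simp
  integrable_density := integrable_const _
  measurable_map := measurable_const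
  hasSum_integral F hF _ _ := by
    convert hasSum_single (f := fun n => a ^ n * ∫ e, F e
      ∂((coeff n (1 : PowerSeries (FiniteMeasure E)) : FiniteMeasure E) : Measure E)) 0
      (fun n hn => by rw [PowerSeries.coeff_one, if_neg hn]; simp) using 1
    simp [toMeasure_one, integral_dirac' _ _ hF.stronglyMeasurable, measureReal_def, volume_pi]

theorem coeff_mul (h : HasMeasureSum (fun n => a ^ n) (fun n => coeff n f) ν g T)
    (h' : HasMeasureSum (fun n => a ^ n) (fun n => coeff n f') ν' g' T') :
    HasMeasureSum (fun n => a ^ n) (fun n => coeff n (f * f')) (ν.prod ν')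
      (fun x => g x.1 * g' x.2) (fun x => T x.1 + T' x.2) := by
  have antidiagonal := ((h.prod h').map (S := fun e => e.1 + e.2) (by fun_prop)).comp_injective
    Finset.HasAntidiagonal.sigmaAntidiagonalEquivProd.injective (by simp)
  simp only [Finset.HasAntidiagonal.sigmaAntidiagonalEquivProd_apply, ← pow_add,
    ← mul_eq_map_prod, fun s : Σ n : ℕ, Finset.HasAntidiagonal.antidiagonal n =>
      Finset.HasAntidiagonal.mem_antidiagonal.1 s.2.2] at antidiagonal
  simpa only [PowerSeries.coeff_mul, Finset.sum_coe_sort _ fun kl : ℕ × ℕ =>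
    coeff kl.1 f * coeff kl.2 f'] using antidiagonal.sum_fiber

theorem coeff_pow {g : ℝ → ℂ} {T : ℝ → E}
    (h : HasMeasureSum (fun n => a ^ n) (fun n => coeff n f) volume g T) (j : ℕ) :
    HasMeasureSum (fun n => a ^ n) (fun n => coeff n (f ^ j)) (volume : Measure (Fin j → ℝ))
      (fun y => ∏ i, g (y i)) (fun y => ∑ i, T (y i)) := by
  induction j with
  | zero => simpa using coeff_one a
  | succ j ih =>
    simp_rw [pow_succ', Fin.prod_univ_succ, Fin.sum_univ_succ]
    exact (h.coeff_mul ih).comp_measurePreserving (MeasurableEquiv.piFinSuccAbove (fun _ => ℝ) 0)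
      (volume_preserving_piFinSuccAbove (fun _ => ℝ) 0)

end HasMeasureSum

end PowerSeries

section FourierInversion

open scoped FourierTransform ContDiff

variable {V F : Type*} [NormedAddCommGroup V] [InnerProductSpace ℝ V] [FiniteDimensional ℝ V]
  [MeasurableSpace V] [BorelSpace V] [NormedAddCommGroup F] [NormedSpace ℂ F] [CompleteSpace F]

theorem integral_fourierInv_smul_eq {f : V → ℂ} {g : V → F} (hf : Integrable f)
    (hg : Integrable g) : ∫ ξ, 𝓕⁻ f ξ • g ξ = ∫ x, f x • 𝓕⁻ g x := by
  have flip_eq : (-innerₗ V).flip = -innerₗ V := by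
    ext x y
    simp [real_inner_comm]
  have := VectorFourier.integral_fourierIntegral_smul_eq_flip (L := -innerₗ V)
    Real.continuous_fourierChar continuous_inner.neg hf hg
  rwa [flip_eq] at this

theorem integral_fourier_smul_eq {f : V → ℂ} {g : V → F} (hf : Integrable f)
    (hg : Integrable g) : ∫ ξ, 𝓕 f ξ • g ξ = ∫ x, f x • 𝓕 g x := by
  simpa using! VectorFourier.integral_fourierIntegral_smul_eq_flip (L := innerₗ V)
    Real.continuous_fourierChar continuous_inner hf hg

theorem fourierInv_fourier_ae_eq {f : V → F} (hf : Integrable f) (hf' : Integrable (𝓕 f)) :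
    𝓕⁻ (𝓕 f) =ᵐ[volume] f := by
  have continuous_fourierInv : Continuous (𝓕⁻ (𝓕 f)) :=
    VectorFourier.fourierIntegral_continuous (L := -innerₗ V) Real.continuous_fourierChar
      continuous_inner.neg hf'
  refine ae_eq_of_integral_contDiff_smul_eq continuous_fourierInv.locallyIntegrable
    hf.locallyIntegrable fun g g_smooth g_compact => ?_
  have G_smooth : ContDiff ℝ ∞ (Complex.ofRealCLM ∘ g) := by fun_prop
  have G_compact : HasCompactSupport (Complex.ofRealCLM ∘ g) := g_compact.comp_left rfl
  let G : 𝓢(V, ℂ) := G_compact.toSchwartzMap G_smooth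
  calc ∫ x, g x • 𝓕⁻ (𝓕 f) x = ∫ x, G x • 𝓕⁻ (𝓕 f) x := by simp [G]
    _ = ∫ ξ, 𝓕⁻ G ξ • 𝓕 f ξ := by
      rw [SchwartzMap.fourierInv_coe, integral_fourierInv_smul_eq G.integrable hf']
    _ = ∫ x, 𝓕 (𝓕⁻ G) x • f x := by
      rw [SchwartzMap.fourier_coe, integral_fourier_smul_eq (𝓕⁻ G).integrable hf]
    _ = ∫ x, g x • f x := by simp [G]

end FourierInversion

section InvFourierLine

open scoped FourierTransform

/-- The inverse Fourier transform on the line with the angular-frequency normalization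
`(2π)⁻¹ ∫ e^{iyη} G(η) dη`. -/
def invFourierLine (G : ℝ → ℂ) (y : ℝ) : ℂ :=
  (((2 * Real.pi)⁻¹ : ℝ) : ℂ) * ∫ η : ℝ, Complex.exp (Complex.I * ((y * η : ℝ) : ℂ)) * G η

theorem invFourierLine_ae_eq {h G : ℝ → ℂ} (hh : Integrable h) (hG : Integrable G)
    (hhG : ∀ η : ℝ, ∫ x : ℝ, Complex.exp (-(Complex.I * η * x)) * h x = G η) :
    invFourierLine G =ᵐ[volume] h := by
  have fourier_h : 𝓕 h = fun w => G (w * (2 * Real.pi)) := by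
    ext w
    rw [Real.fourier_real_eq_integral_exp_smul, ← hhG]
    refine integral_congr_ae (.of_forall fun x => ?_)
    simp only [smul_eq_mul]
    congr 2
    push_cast
    ring
  have fourierInv_h (y : ℝ) : 𝓕⁻ (𝓕 h) y = invFourierLine G y := by
    rw [fourier_h, Real.fourierInv_eq', invFourierLine, ← Complex.real_smul]
    have := Measure.integral_comp_mul_right
      (fun η : ℝ => Complex.exp (Complex.I * ((y * η : ℝ) : ℂ)) * G η) (2 * Real.pi)
    rw [abs_of_pos (by positivity)] at this
    rw [← this]
    refine integral_congr_ae (.of_forall fun w => ?_)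
    simp only [smul_eq_mul]
    congr 2
    simp [mul_comm, mul_assoc]
  rw [← show 𝓕⁻ (𝓕 h) = invFourierLine G from funext fourierInv_h]
  refine fourierInv_fourier_ae_eq hh ?_
  rw [fourier_h]
  exact hG.comp_mul_right' (by positivity)

end InvFourierLine

section LogDensity

theorem norm_mul_lt_one {a x : ℂ} (ha : ‖a‖ < 1) (hx : ‖x‖ ≤ 1) : ‖a * x‖ < 1 := by
  rw [norm_mul]
  exact (mul_le_of_le_one_right (norm_nonneg a) hx).trans_lt ha

theorem norm_neg_log_one_sub_le {z : ℂ} {r : ℝ} (hr : r < 1) (hz : ‖z‖ ≤ r) :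
    ‖-Complex.log (1 - z)‖ ≤ (1 - r)⁻¹ * ‖z‖ := by
  have one_sub_pos : 0 < 1 - r := sub_pos.2 hr
  have norm_le := Complex.norm_log_one_add_le (z := -z) (by rw [norm_neg]; exact hz.trans_lt hr)
  rw [← sub_eq_add_neg, norm_neg] at norm_le
  have := norm_nonneg z
  calc ‖-Complex.log (1 - z)‖ ≤ ‖z‖ ^ 2 * (1 - ‖z‖)⁻¹ / 2 + ‖z‖ := by rwa [norm_neg]
    _ ≤ ‖z‖ ^ 2 * (1 - r)⁻¹ / 2 + ‖z‖ := by gcongr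
    _ = (1 - r)⁻¹ * (‖z‖ * (‖z‖ / 2 + (1 - r))) := by field_simp
    _ ≤ (1 - r)⁻¹ * ‖z‖ := by gcongr; nlinarith

theorem integrable_neg_log_one_sub {α : Type*} [MeasurableSpace α] {ν : Measure α} {u : α → ℂ}
    (hu : Integrable u ν) {a : ℂ} (ha : ‖a‖ < 1) (norm_u : ∀ x, ‖u x‖ ≤ 1) :
    Integrable (fun x => -Complex.log (1 - a * u x)) ν := by
  refine (hu.norm.const_mul ((1 - ‖a‖)⁻¹ * ‖a‖)).mono' ?_ (.of_forall fun x => ?_)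
  · exact ((hu.aemeasurable.const_mul a).const_sub 1).clog.neg.aestronglyMeasurable
  · refine (norm_neg_log_one_sub_le ha ?_).trans_eq (by rw [norm_mul, mul_assoc])
    rw [norm_mul]
    exact mul_le_of_le_one_right (norm_nonneg a) (norm_u x)

/-- The function whose Fourier transform is `-log (1 - a ρ̂)`; it is the density of the complex
measure `∑ aⁿ ρⁿ / n` formed from the convolution powers of the law `ρ`. -/
def logDensity (ρ : FiniteMeasure ℝ) (a : ℂ) : ℝ → ℂ :=
  invFourierLine fun η => -Complex.log (1 - a * charFun ρ (-η))

open scoped NNReal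

variable {ρ : FiniteMeasure ℝ}

theorem mass_eq_one [IsProbabilityMeasure (ρ : Measure ℝ)] : ρ.mass = 1 := by
  rw [← ENNReal.coe_inj, FiniteMeasure.ennreal_mass, measure_univ, ENNReal.coe_one]

theorem charFun_pow (ρ : FiniteMeasure ℝ) (n : ℕ) (t : ℝ) :
    charFun ((ρ ^ n : FiniteMeasure ℝ) : Measure ℝ) t = charFun ρ t ^ n := by
  induction n with
  | zero => simp [toMeasure_one]
  | succ n ih => rw [pow_succ, pow_succ, toMeasure_mul, charFun_conv, ih]

theorem pow_absolutelyContinuous (hac : (ρ : Measure ℝ) ≪ volume) {n : ℕ} (hn : n ≠ 0) :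
    ((ρ ^ n : FiniteMeasure ℝ) : Measure ℝ) ≪ volume := by
  obtain ⟨n, rfl⟩ := Nat.exists_eq_succ_of_ne_zero hn
  rw [pow_succ, toMeasure_mul]
  exact Measure.conv_absolutelyContinuous hac

theorem summable_mass_pow [IsProbabilityMeasure (ρ : Measure ℝ)] {a : ℂ} (ha : ‖a‖ < 1) :
    Summable fun n : ℕ => ‖a ^ n‖ * ((n : ℝ≥0)⁻¹ • ρ ^ n : FiniteMeasure ℝ).mass := by
  refine (Complex.hasSum_taylorSeries_neg_log ha).summable.norm.congr fun n => ?_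
  rw [← massHom_apply, map_smul, map_pow, massHom_apply, mass_eq_one, one_pow, norm_div,
    div_eq_mul_inv]
  simp

theorem hasMeasureSum_pow [IsProbabilityMeasure (ρ : Measure ℝ)]
    (hac : (ρ : Measure ℝ) ≪ volume) (hint : Integrable (charFun (ρ : Measure ℝ))) {a : ℂ}
    (ha : ‖a‖ < 1) :
    HasMeasureSum (fun n => a ^ n) (fun n : ℕ => (n : ℝ≥0)⁻¹ • ρ ^ n) volume (logDensity ρ a)
      id := by
  have absolutelyContinuous (n : ℕ) :
      (((n : ℝ≥0)⁻¹ • ρ ^ n : FiniteMeasure ℝ) : Measure ℝ) ≪ volume := by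
    rcases eq_or_ne n 0 with rfl | hn
    · simp [Measure.AbsolutelyContinuous.zero]
    · exact (pow_absolutelyContinuous hac hn).smul_left _
  obtain ⟨h, hh⟩ := exists_hasMeasureSum (summable_mass_pow ha) absolutelyContinuous
  refine hh.congr_density (invFourierLine_ae_eq hh.integrable_density
    (integrable_neg_log_one_sub hint.comp_neg ha fun η => norm_charFun_le_one _) fun η => ?_)
  have exp_eq (x : ℝ) :
      Complex.exp (-(Complex.I * η * x)) = Complex.exp (((-η : ℝ) : ℂ) * x * Complex.I) := by
    congr 1
    push_cast
    ring
  have norm_exp (x : ℝ) : ‖Complex.exp (-(Complex.I * η * x))‖ ≤ 1 := by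
    rw [exp_eq, ← Complex.ofReal_mul, Complex.norm_exp_ofReal_mul_I]
  refine (hh.hasSum_integral (by fun_prop) norm_exp).unique ?_
  refine (Complex.hasSum_taylorSeries_neg_log
    (norm_mul_lt_one ha (norm_charFun_le_one (-η)))).congr_fun fun n => ?_
  rw [mul_pow, ← charFun_pow, charFun_apply_real, FiniteMeasure.toMeasure_smul,
    integral_smul_nnreal_measure]
  simp only [exp_eq, NNReal.smul_def, Complex.real_smul]
  push_cast
  ring

theorem hasMeasureSum_logSeries [IsProbabilityMeasure (ρ : Measure ℝ)]
    (hac : (ρ : Measure ℝ) ≪ volume) (hint : Integrable (charFun (ρ : Measure ℝ))) {a : ℂ}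
    (ha : ‖a‖ < 1) :
    HasMeasureSum (fun n => a ^ n) (fun n => PowerSeries.coeff n (logSeries ρ)) volume
      (logDensity ρ a) (fun y => (y, max 0 y)) := by
  simpa only [logSeries, PowerSeries.coeff_mk, FiniteMeasure.map_smul, id] using
    (hasMeasureSum_pow hac hint ha).map (S := fun y => (y, max 0 y)) (by fun_prop)

end LogDensity

section PhiGeom

open PowerSeries

/-- The power series `f` converges absolutely at `z`, with sum `v`. -/
def HasAbsEval (f : PowerSeries ℂ) (z v : ℂ) : Prop :=
  (Summable fun n => ‖coeff n f * z ^ n‖) ∧ HasSum (fun n => coeff n f * z ^ n) v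

theorem coeff_mul_mul_pow (f g : PowerSeries ℂ) (z : ℂ) (n : ℕ) :
    coeff n (f * g) * z ^ n = ∑ kl ∈ Finset.HasAntidiagonal.antidiagonal n,
      (coeff kl.1 f * z ^ kl.1) * (coeff kl.2 g * z ^ kl.2) := by
  rw [coeff_mul, Finset.sum_mul]
  refine Finset.sum_congr rfl fun kl h => ?_
  rw [← Finset.HasAntidiagonal.mem_antidiagonal.1 h, pow_add]
  ring

theorem HasAbsEval.mul {f g : PowerSeries ℂ} {z v w : ℂ} (hf : HasAbsEval f z v)
    (hg : HasAbsEval g z w) : HasAbsEval (f * g) z (v * w) := by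
  have summable_cauchy := summable_norm_sum_mul_antidiagonal_of_summable_norm hf.1 hg.1
  have tsum_cauchy := tsum_mul_tsum_eq_tsum_sum_antidiagonal_of_summable_norm hf.1 hg.1
  simp_rw [← coeff_mul_mul_pow] at summable_cauchy tsum_cauchy
  rw [← hf.2.tsum_eq, ← hg.2.tsum_eq, tsum_cauchy]
  exact ⟨summable_cauchy, summable_cauchy.of_norm.hasSum⟩

theorem HasAbsEval.one (z : ℂ) : HasAbsEval 1 z 1 := by
  have coeff_eq_zero (n : ℕ) (hn : n ≠ 0) : coeff n (1 : PowerSeries ℂ) * z ^ n = 0 := by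
    rw [coeff_one, if_neg hn, zero_mul]
  refine ⟨summable_of_ne_finset_zero (s := {0}) fun n hn => ?_, ?_⟩
  · rw [coeff_eq_zero n (by simpa using hn), norm_zero]
  · simpa using hasSum_single (f := fun n => coeff n (1 : PowerSeries ℂ) * z ^ n) 0 coeff_eq_zero

theorem HasAbsEval.prod {ι : Type*} (s : Finset ι) {f : ι → PowerSeries ℂ} {z : ℂ} {v : ι → ℂ}
    (h : ∀ i ∈ s, HasAbsEval (f i) z (v i)) : HasAbsEval (∏ i ∈ s, f i) z (∏ i ∈ s, v i) := by
  classical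
  induction s using Finset.induction_on with
  | empty => simpa using HasAbsEval.one z
  | insert i s hi ih =>
    rw [Finset.prod_insert hi, Finset.prod_insert hi]
    exact (h i (s.mem_insert_self i)).mul (ih fun k hk => h k (Finset.mem_insert_of_mem hk))

/-- The Taylor series `∑ xⁿ zⁿ / n` of `-log (1 - x z)` in the variable `z`; its `0`-th coefficient
vanishes because `1 / 0 = 0`. -/
def negLogSeries (x : ℂ) : PowerSeries ℂ := PowerSeries.mk fun n => x ^ n / (n : ℂ)

theorem constantCoeff_negLogSeries (x : ℂ) : constantCoeff (negLogSeries x) = 0 := by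
  rw [← coeff_zero_eq_constantCoeff_apply, negLogSeries, coeff_mk, Nat.cast_zero, div_zero]

theorem hasAbsEval_negLogSeries {x a : ℂ} (h : ‖a * x‖ < 1) :
    HasAbsEval (negLogSeries x) a (-Complex.log (1 - a * x)) := by
  have coeff_mul_pow (n : ℕ) : coeff n (negLogSeries x) * a ^ n = (a * x) ^ n / n := by
    rw [negLogSeries, coeff_mk, mul_pow]
    ring
  have taylor := Complex.hasSum_taylorSeries_neg_log h
  simp only [HasAbsEval, coeff_mul_pow]
  exact ⟨taylor.summable.norm, taylor⟩

theorem phiMonomial_eq_coeff (j m : ℕ) (x : Fin j → ℂ) :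
    phiMonomial j m x = coeff m (∏ i, negLogSeries (x i)) := by
  have one_le_of_ne_zero (l : Fin j → ℕ) (hl : ∏ i, x i ^ l i / (l i : ℂ) ≠ 0) (i : Fin j) :
      1 ≤ l i := by
    refine Nat.one_le_iff_ne_zero.2 fun hi => Finset.prod_ne_zero_iff.1 hl i (Finset.mem_univ i) ?_
    rw [hi, Nat.cast_zero, div_zero]
  rw [phiMonomial, coeff_prod, Finset.sum_filter_of_ne fun l _ hl => one_le_of_ne_zero l hl]
  refine Finset.sum_bij' (fun l _ => Finsupp.equivFunOnFinite.symm l) (fun l _ => ⇑l)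
    (fun l hl => by simpa using hl) (fun l hl => by simpa using hl) (fun l _ => rfl)
    (fun l _ => by ext; rfl) fun l _ => by simp [negLogSeries]

theorem hasFPowerSeriesAt_geom (a : ℂ) : HasFPowerSeriesAt (geom a)
    (FormalMultilinearSeries.ofScalars ℂ fun n => if n = 0 then 0 else a ^ n) 0 := by
  have norm_lt_one : ∀ᶠ z : ℂ in nhds 0, ‖a * z‖ < 1 :=
    (show ContinuousAt (fun z : ℂ => ‖a * z‖) 0 by fun_prop).eventually (gt_mem_nhds (by simp))
  rw [hasFPowerSeriesAt_iff]
  filter_upwards [norm_lt_one] with z hz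
  have one_sub_ne_zero : 1 - a * z ≠ 0 := fun h => by
    rw [← sub_eq_zero.1 h, norm_one] at hz
    exact hz.false
  convert (hasSum_geometric_of_norm_lt_one hz).sub (hasSum_ite_eq 0 (1 : ℂ)) using 1
  · ext n
    rcases eq_or_ne n 0 with rfl | hn
    · simp [FormalMultilinearSeries.coeff_ofScalars]
    · simp [FormalMultilinearSeries.coeff_ofScalars, hn, mul_pow, mul_comm]
  · rw [geom, zero_add]
    field_simp
    ring

theorem taylorCoeff_geom (a : ℂ) (m : ℕ) :
    taylorCoeff (geom a) m = if m = 0 then 0 else a ^ m := by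
  have h := hasFPowerSeriesAt_geom a
  have coeff_eq := congrArg (fun p => FormalMultilinearSeries.coeff p m)
    (h.analyticAt.hasFPowerSeriesAt.eq_formalMultilinearSeries h)
  simpa [FormalMultilinearSeries.coeff_ofScalars, taylorCoeff] using coeff_eq

theorem taylorCoeff_geom_mul_phiMonomial (a : ℂ) {j : ℕ} (hj : j ≠ 0) (m : ℕ) (x : Fin j → ℂ) :
    taylorCoeff (geom a) m * phiMonomial j m x = coeff m (∏ i, negLogSeries (x i)) * a ^ m := by
  rw [taylorCoeff_geom, phiMonomial_eq_coeff]
  split_ifs with hm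
  · rw [hm, coeff_zero_eq_constantCoeff_apply, map_prod,
      Finset.prod_eq_zero (Finset.mem_univ ⟨0, Nat.pos_of_ne_zero hj⟩)
        (constantCoeff_negLogSeries _), zero_mul, zero_mul]
  · rw [mul_comm]

theorem hasSum_Phi_geom (a : ℂ) {j : ℕ} (hj : j ≠ 0) {x : Fin j → ℂ} (hx : ∀ i, ‖a * x i‖ < 1) :
    HasSum (fun m => taylorCoeff (geom a) m * phiMonomial j m x)
      (∏ i, -Complex.log (1 - a * x i)) := by
  simp_rw [taylorCoeff_geom_mul_phiMonomial a hj]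
  exact (HasAbsEval.prod _ fun i _ => hasAbsEval_negLogSeries (hx i)).2

end PhiGeom

section Hat

open scoped FourierTransform

theorem hat_eq_fourier (φ : ℝ → ℝ) (η : ℝ) :
    hat φ η = (𝓕 fun y => (φ y : ℂ)) ((2 * Real.pi)⁻¹ * η) := by
  rw [Real.fourier_real_eq_integral_exp_smul, hat]
  refine integral_congr_ae (.of_forall fun y => ?_)
  simp only [smul_eq_mul]
  congr 2
  have : (Real.pi : ℂ) ≠ 0 := Complex.ofReal_ne_zero.2 Real.pi_ne_zero
  push_cast
  field_simp

theorem integrable_hat (φ : 𝓢(ℝ, ℝ)) : Integrable (hat φ) := by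
  simp_rw [funext (hat_eq_fourier φ)]
  exact (𝓕 (SchwartzMap.postcompCLM (𝕜 := ℝ) Complex.ofRealCLM φ)).integrable.comp_mul_left'
    (by positivity)

theorem hat_eq_charFun {φ : ℝ → ℝ} (hφ : AEMeasurable φ) (hφ0 : ∀ x, 0 ≤ φ x) (η : ℝ) :
    hat φ η = charFun (volume.withDensity fun x => ENNReal.ofReal (φ x)) (-η) := by
  rw [charFun_apply_real, integral_withDensity_eq_integral_toReal_smul₀ hφ.ennreal_ofReal
    (.of_forall fun _ => ENNReal.ofReal_lt_top), hat]
  refine integral_congr_ae (.of_forall fun y => ?_)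
  simp only [ENNReal.toReal_ofReal (hφ0 y), Complex.real_smul]
  rw [mul_comm]
  congr 2
  push_cast
  ring

end Hat

section Symbol

variable {φ : ℝ → ℝ} {a b : ℂ} {j k : ℕ}

theorem symbol_eq_prod_log (hφ : ∀ η, ‖hat φ η‖ ≤ 1) (ha : ‖a‖ < 1) (hb : ‖b‖ < 1) (hj : j ≠ 0)
    (hk : k ≠ 0) :
    symbol φ a b j k = fun v => (∏ i, -Complex.log (1 - a * hat φ (v.1 i))) *
      ∏ i, -Complex.log (1 - b * hat φ (v.2 i)) := by
  funext v
  rw [symbol, Phi, Phi, (hasSum_Phi_geom a hj fun i => norm_mul_lt_one ha (hφ _)).tsum_eq,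
    (hasSum_Phi_geom b hk fun i => norm_mul_lt_one hb (hφ _)).tsum_eq]

theorem integrable_symbol (hint : Integrable (hat φ)) (hφ : ∀ η, ‖hat φ η‖ ≤ 1) (ha : ‖a‖ < 1)
    (hb : ‖b‖ < 1) (hj : j ≠ 0) (hk : k ≠ 0) : Integrable (symbol φ a b j k) := by
  rw [symbol_eq_prod_log hφ ha hb hj hk]
  exact (Integrable.fintype_prod fun _ : Fin j => integrable_neg_log_one_sub hint ha hφ).mul_prod
    (Integrable.fintype_prod fun _ : Fin k => integrable_neg_log_one_sub hint hb hφ)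

theorem prod_invFourierLine (G : ℝ → ℂ) (y : Fin j → ℝ) :
    ∏ i, invFourierLine G (y i) = (((2 * Real.pi)⁻¹ : ℝ) : ℂ) ^ j *
      ∫ η : Fin j → ℝ, ∏ i, (Complex.exp (Complex.I * ((y i * η i : ℝ) : ℂ)) * G (η i)) := by
  simp_rw [invFourierLine]
  rw [Finset.prod_mul_distrib, Finset.prod_const, Finset.card_univ, Fintype.card_fin,
    integral_fintype_prod_volume_eq_prod fun i (η : ℝ) =>
      Complex.exp (Complex.I * ((y i * η : ℝ) : ℂ)) * G η]

theorem invFourier_prod (G G' : ℝ → ℂ) (y : Fin j → ℝ) (z : Fin k → ℝ) :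
    invFourier (fun v => (∏ i, G (v.1 i)) * ∏ i, G' (v.2 i)) y z =
      (∏ i, invFourierLine G (y i)) * ∏ i, invFourierLine G' (z i) := by
  rw [invFourier, prod_invFourierLine, prod_invFourierLine, mul_mul_mul_comm, ← integral_prod_mul,
    ← pow_add]
  congr 1
  · rw [← inv_pow, Complex.ofReal_pow]
  · refine integral_congr_ae (.of_forall fun v => ?_)
    simp only [Finset.prod_mul_distrib, ← Complex.exp_sum]
    rw [mul_mul_mul_comm, ← Complex.exp_add]
    push_cast
    rw [mul_add, Finset.mul_sum, Finset.mul_sum]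

end Symbol

section Interchange

open PowerSeries
open scoped NNReal Nat

theorem HasMeasureSum.exists_hasSum_comm {ι κ E : Type*} [MeasurableSpace E] {A : ι → Type*}
    [∀ i, MeasurableSpace (A i)] {B : κ → Type*} [∀ k, MeasurableSpace (B k)] {c : ι → ℂ}
    {d : κ → ℂ} {m : ι → κ → FiniteMeasure E} {ν : ∀ i, Measure (A i)} {g : ∀ i, A i → ℂ}
    {T : ∀ i, A i → E} {ν' : ∀ k, Measure (B k)} {g' : ∀ k, B k → ℂ} {T' : ∀ k, B k → E}
    (hm : Summable fun x : ι × κ => ‖c x.1 * d x.2‖ * (m x.1 x.2).mass)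
    (row : ∀ i, HasMeasureSum d (m i) (ν i) (g i) (T i))
    (col : ∀ k, HasMeasureSum c (fun i => m i k) (ν' k) (g' k) (T' k))
    {F : E → ℂ} (hF : Measurable F) {C : ℝ} (hC : ∀ e, ‖F e‖ ≤ C) :
    ∃ S, HasSum (fun i => c i * ∫ x, F (T i x) * g i x ∂ν i) S ∧
      HasSum (fun k => d k * ∫ x, F (T' k x) * g' k x ∂ν' k) S := by
  have hasSum := (summable_mul_integral hm hC).hasSum
  refine ⟨_, hasSum.prod_fiberwise fun i => ?_,
    ((Equiv.prodComm κ ι).hasSum_iff.2 hasSum).prod_fiberwise fun k => ?_⟩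
  · simpa only [mul_assoc] using ((row i).hasSum_integral hF hC).mul_left (c i)
  · simpa only [Function.comp_def, Equiv.prodComm_apply, Prod.swap_prod_mk, mul_left_comm (d k),
      mul_assoc] using ((col k).hasSum_integral hF hC).mul_left (d k)

theorem HasMeasureSum.pnat {A E : Type*} [MeasurableSpace A] [MeasurableSpace E] {c : ℕ → ℂ}
    {m : ℕ → FiniteMeasure E} {ν : Measure A} {g : A → ℂ} {T : A → E}
    (h : HasMeasureSum c m ν g T) (h0 : m 0 = 0) :
    HasMeasureSum (fun n : ℕ+ => c n) (fun n : ℕ+ => m n) ν g T := by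
  refine h.comp_injective PNat.coe_injective fun n hn => ?_
  rwa [not_not.1 fun h => hn ⟨⟨n, Nat.pos_of_ne_zero h⟩, rfl⟩]

variable {E : Type*} [MeasurableSpace E] [AddCommMonoid E] [MeasurableAdd₂ E]
  {f : PowerSeries (FiniteMeasure E)}

theorem mass_expCoeff (f : PowerSeries (FiniteMeasure E)) (n : ℕ) :
    (expCoeff ℝ≥0 f n).mass =
      ∑ j ∈ Finset.range (n + 1), (j ! : ℝ≥0)⁻¹ * (coeff n (f ^ j)).mass := by
  simp only [expCoeff, ← massHom_apply, map_sum, map_smul, smul_eq_mul]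

theorem integral_expCoeff (f : PowerSeries (FiniteMeasure E)) (n : ℕ) {F : E → ℂ}
    (hF : Measurable F) {C : ℝ} (hC : ∀ e, ‖F e‖ ≤ C) :
    ∫ e, F e ∂((expCoeff ℝ≥0 f n : FiniteMeasure E) : Measure E) =
      ∑ j ∈ Finset.range (n + 1),
        1 / (j ! : ℂ) * ∫ e, F e ∂((coeff n (f ^ j) : FiniteMeasure E) : Measure E) := by
  rw [expCoeff, FiniteMeasure.toMeasure_sum,
    integral_finsetSum_measure fun j _ => integrable_of_norm_le hF hC]
  refine Finset.sum_congr rfl fun j _ => ?_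
  rw [FiniteMeasure.toMeasure_smul, integral_smul_nnreal_measure, NNReal.smul_def,
    Complex.real_smul]
  simp

theorem hasMeasureSum_expCoeff (hf : constantCoeff f = 0) (n : ℕ) :
    HasMeasureSum (fun j : ℕ => 1 / (j ! : ℂ)) (fun j => coeff n (f ^ j))
      ((expCoeff ℝ≥0 f n : FiniteMeasure E) : Measure E) (fun _ => 1) id := by
  have coeff_pow_eq_zero {j : ℕ} (hj : j ∉ Finset.range (n + 1)) : coeff n (f ^ j) = 0 :=
    coeff_pow_of_lt hf (by simpa using hj)
  refine ⟨summable_of_ne_finset_zero (s := Finset.range (n + 1)) fun j hj => ?_,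
    integrable_const 1, measurable_id, fun F hF C hC => ?_⟩
  · rw [coeff_pow_eq_zero hj, FiniteMeasure.zero_mass, NNReal.coe_zero, mul_zero]
  · simp only [id, mul_one, integral_expCoeff f n hF hC]
    exact hasSum_sum_of_ne_finset_zero fun j hj => by simp [coeff_pow_eq_zero hj]

theorem summable_mass_coeff_pow (hf : constantCoeff f = 0) {a : ℂ}
    (hsum : Summable fun n => ‖a ^ n‖ * (expCoeff ℝ≥0 f n).mass) :
    Summable fun x : ℕ × ℕ => ‖1 / (x.1 ! : ℂ) * a ^ x.2‖ * (coeff x.2 (f ^ x.1)).mass := by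
  have hasSum_mass (n : ℕ) : HasSum (fun j : ℕ => ‖1 / (j ! : ℂ) * a ^ n‖ * (coeff n (f ^ j)).mass)
      (‖a ^ n‖ * (expCoeff ℝ≥0 f n).mass) := by
    have mass_eq : ‖a ^ n‖ * (expCoeff ℝ≥0 f n).mass = ∑ j ∈ Finset.range (n + 1),
        ‖1 / (j ! : ℂ) * a ^ n‖ * (coeff n (f ^ j)).mass := by
      rw [mass_expCoeff, NNReal.coe_sum, Finset.mul_sum]
      refine Finset.sum_congr rfl fun j _ => ?_
      simp only [norm_mul, norm_div, norm_one, Complex.norm_natCast]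
      push_cast
      ring
    rw [mass_eq]
    refine hasSum_sum_of_ne_finset_zero fun j hj => ?_
    rw [coeff_pow_of_lt hf (by simpa using hj), FiniteMeasure.zero_mass, NNReal.coe_zero, mul_zero]
  refine (Equiv.prodComm ℕ ℕ).summable_iff.1
    ((summable_prod_of_nonneg fun x =>
      mul_nonneg (norm_nonneg _) NNReal.zero_le_coe).2 ⟨fun n => (hasSum_mass n).summable, ?_⟩)
  exact hsum.congr fun n => (hasSum_mass n).tsum_eq.symm

theorem exists_hasSum_expCoeff_prod {f f' : PowerSeries (FiniteMeasure E)} {a b : ℂ}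
    {g g' : ℝ → ℂ} {T T' : ℝ → E} (hf : constantCoeff f = 0) (hf' : constantCoeff f' = 0)
    (h : HasMeasureSum (fun n => a ^ n) (fun n => coeff n f) volume g T)
    (h' : HasMeasureSum (fun n => b ^ n) (fun n => coeff n f') volume g' T')
    (hsum : Summable fun n => ‖a ^ n‖ * (expCoeff ℝ≥0 f n).mass)
    (hsum' : Summable fun n => ‖b ^ n‖ * (expCoeff ℝ≥0 f' n).mass)
    {F : E × E → ℂ} (hF : Measurable F) {C : ℝ} (hC : ∀ e, ‖F e‖ ≤ C) :
    ∃ S, HasSum (fun jk : ℕ+ × ℕ+ => 1 / ((jk.1 : ℕ)! : ℂ) * (1 / ((jk.2 : ℕ)! : ℂ)) *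
        ∫ w : (Fin jk.1 → ℝ) × (Fin jk.2 → ℝ), F (∑ i, T (w.1 i), ∑ i, T' (w.2 i)) *
          ((∏ i, g (w.1 i)) * ∏ i, g' (w.2 i))) S ∧
      HasSum (fun pq : ℕ+ × ℕ+ => a ^ (pq.1 : ℕ) * b ^ (pq.2 : ℕ) *
        ∫ e, F e ∂((expCoeff ℝ≥0 f pq.1 : FiniteMeasure E) : Measure E).prod
          (expCoeff ℝ≥0 f' pq.2 : FiniteMeasure E)) S := by
  have coeff_zero_pow {f : PowerSeries (FiniteMeasure E)} (hf : constantCoeff f = 0) (j : ℕ+) :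
      coeff 0 (f ^ (j : ℕ)) = 0 := coeff_pow_of_lt hf j.pos
  have coeff_pow_zero (f : PowerSeries (FiniteMeasure E)) (p : ℕ+) :
      coeff (p : ℕ) (f ^ 0) = 0 := by rw [pow_zero, PowerSeries.coeff_one, if_neg p.ne_zero]
  have index_injective : Function.Injective fun x : (ℕ+ × ℕ+) × (ℕ+ × ℕ+) =>
      (((x.1.1 : ℕ), (x.2.1 : ℕ)), ((x.1.2 : ℕ), (x.2.2 : ℕ))) := fun x y h => by
    simp only [Prod.mk.injEq, PNat.coe_inj] at h
    exact Prod.ext (Prod.ext h.1.1 h.2.1) (Prod.ext h.1.2 h.2.2)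
  have summable_mass := (summable_mass_prod (summable_mass_coeff_pow hf hsum)
    (summable_mass_coeff_pow hf' hsum')).comp_injective index_injective
  obtain ⟨S, hasSum_row, hasSum_col⟩ := HasMeasureSum.exists_hasSum_comm
    (c := fun jk : ℕ+ × ℕ+ => 1 / ((jk.1 : ℕ)! : ℂ) * (1 / ((jk.2 : ℕ)! : ℂ)))
    (m := fun jk (pq : ℕ+ × ℕ+) =>
      (coeff pq.1 (f ^ (jk.1 : ℕ))).prod (coeff pq.2 (f' ^ (jk.2 : ℕ))))
    (by simpa only [Function.comp_def, mul_mul_mul_comm] using summable_mass)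
    (fun jk => ((h.coeff_pow jk.1).pnat (coeff_zero_pow hf _)).prod
      ((h'.coeff_pow jk.2).pnat (coeff_zero_pow hf' _)))
    (fun pq => ((hasMeasureSum_expCoeff hf pq.1).pnat (coeff_pow_zero f _)).prod
      ((hasMeasureSum_expCoeff hf' pq.2).pnat (coeff_pow_zero f' _))) hF hC
  exact ⟨S, hasSum_row, by simpa only [id, mul_one] using hasSum_col⟩

end Interchange

section StatePhase

/-- The factor `exp (iα S_p + iβ T_{p+q})` as a function of the state `(s, t)` of the walk after
`p` steps and of the state `(s', t')` of the walk formed by the next `q` steps: the running maximum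
of the whole walk is `max t (s + t')`. -/
def statePhase (α β : ℝ) (e : (ℝ × ℝ) × (ℝ × ℝ)) : ℂ :=
  Complex.exp (Complex.I * ((α * e.1.1 + β * max e.1.2 (e.1.1 + e.2.2) : ℝ) : ℂ))

theorem measurable_statePhase (α β : ℝ) : Measurable (statePhase α β) := by
  unfold statePhase
  fun_prop

theorem norm_statePhase_le_one (α β : ℝ) (e : (ℝ × ℝ) × (ℝ × ℝ)) : ‖statePhase α β e‖ ≤ 1 :=
  (Complex.norm_exp_I_mul_ofReal _).le

theorem statePhase_walkState {Ω : Type*} (α β : ℝ) (X : ℕ → Ω → ℝ) (p q : ℕ) (ω : Ω) :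
    statePhase α β (walkState X p ω, walkState (fun i => X (p + i)) q ω) =
      Complex.exp (Complex.I * ((α * position X p ω + β * runningMax X (p + q) ω : ℝ) : ℂ)) := by
  rw [runningMax_add]
  rfl

theorem statePhase_sum {j k : ℕ} (α β : ℝ) (y : Fin j → ℝ) (z : Fin k → ℝ) :
    statePhase α β (∑ i, (y i, max 0 (y i)), ∑ i, (z i, max 0 (z i))) =
      Complex.exp (Complex.I * ((α * ∑ i, y i + β * weight y z : ℝ) : ℂ)) := by
  have sum_eq : ∑ i, y i = ∑ i, max 0 (y i) + ∑ i, min 0 (y i) := by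
    simp only [← Finset.sum_add_distrib, max_add_min, zero_add]
  have weight_eq : max (∑ i, max 0 (y i)) (∑ i, y i + ∑ i, max 0 (z i)) = weight y z := by
    rw [weight, ← max_add_add_left, add_zero, ← add_assoc, ← sum_eq]
  simp only [statePhase, Prod.fst_sum, Prod.snd_sum, weight_eq]

end StatePhase

section GeneratingSeries

variable {Ω : Type*} [MeasurableSpace Ω] {μ : Measure Ω} {X : ℕ → Ω → ℝ} {ρ : FiniteMeasure ℝ}
  {a b : ℂ} {α β : ℝ} {j k : ℕ}

theorem integral_walkState_prod (hX : ∀ i, HasLaw (X i) ρ μ) (hindep : iIndepFun X μ) (p q : ℕ)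
    {F : (ℝ × ℝ) × (ℝ × ℝ) → ℂ} (hF : Measurable F) :
    ∫ ω, F (walkState X p ω, walkState (fun i => X (p + i)) q ω) ∂μ =
      ∫ e, F e ∂((walkLaw ρ p : Measure (ℝ × ℝ)).prod (walkLaw ρ q)) := by
  have := hindep.isProbabilityMeasure
  have law_first := hasLaw_walkState hX hindep p
  have law_last := hasLaw_walkState (fun i => hX (p + i))
    (hindep.precomp (add_right_injective p)) q
  have indep := indepFun_walkState (fun i => (hX i).aemeasurable) hindep p q
  rw [← law_first.map_eq, ← law_last.map_eq,
    ← (indepFun_iff_map_prod_eq_prod_map_map law_first.aemeasurable law_last.aemeasurable).1 indep,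
    integral_map (law_first.aemeasurable.prodMk law_last.aemeasurable) hF.aestronglyMeasurable]

theorem summable_mass_expCoeff_logSeries [IsProbabilityMeasure (ρ : Measure ℝ)] (ha : ‖a‖ < 1) :
    Summable fun n => ‖a ^ n‖ * (expCoeff NNReal (logSeries ρ) n).mass := by
  simp only [← walkLaw_eq_expCoeff, mass_walkLaw, mass_eq_one, one_pow, NNReal.coe_one, mul_one]
  exact (summable_geometric_of_norm_lt_one ha).norm

theorem exists_hasSum_walk (hac : (ρ : Measure ℝ) ≪ volume)
    (hint : Integrable (charFun (ρ : Measure ℝ))) (hX : ∀ i, HasLaw (X i) ρ μ)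
    (hindep : iIndepFun X μ) (ha : ‖a‖ < 1) (hb : ‖b‖ < 1) {F : (ℝ × ℝ) × (ℝ × ℝ) → ℂ}
    (hF : Measurable F) {C : ℝ} (hC : ∀ e, ‖F e‖ ≤ C) :
    ∃ S, HasSum (fun jk : ℕ+ × ℕ+ =>
        1 / ((jk.1 : ℕ).factorial : ℂ) * (1 / ((jk.2 : ℕ).factorial : ℂ)) *
        ∫ w : (Fin jk.1 → ℝ) × (Fin jk.2 → ℝ),
          F (∑ i, (w.1 i, max 0 (w.1 i)), ∑ i, (w.2 i, max 0 (w.2 i))) *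
            ((∏ i, logDensity ρ a (w.1 i)) * ∏ i, logDensity ρ b (w.2 i))) S ∧
      HasSum (fun pq : ℕ+ × ℕ+ => a ^ (pq.1 : ℕ) * b ^ (pq.2 : ℕ) *
        ∫ ω, F (walkState X pq.1 ω, walkState (fun i => X (pq.1 + i)) pq.2 ω) ∂μ) S := by
  have := hindep.isProbabilityMeasure
  have : IsProbabilityMeasure (ρ : Measure ℝ) := (hX 0).isProbabilityMeasure_iff.1 inferInstance
  have constantCoeff_logSeries : PowerSeries.constantCoeff (logSeries ρ) = 0 := by simp [logSeries]
  simp only [integral_walkState_prod hX hindep _ _ hF, walkLaw_eq_expCoeff]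
  exact exists_hasSum_expCoeff_prod constantCoeff_logSeries constantCoeff_logSeries
    (hasMeasureSum_logSeries hac hint ha) (hasMeasureSum_logSeries hac hint hb)
    (summable_mass_expCoeff_logSeries ha) (summable_mass_expCoeff_logSeries hb) hF hC

variable [IsProbabilityMeasure (ρ : Measure ℝ)]

theorem integrand_eq_statePhase_mul {φ : ℝ → ℝ} (hφ : ∀ η, hat φ η = charFun (ρ : Measure ℝ) (-η))
    (ha : ‖a‖ < 1) (hb : ‖b‖ < 1) (hj : j ≠ 0) (hk : k ≠ 0) :
    integrand φ a b α β j k = fun w =>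
      statePhase α β (∑ i, (w.1 i, max 0 (w.1 i)), ∑ i, (w.2 i, max 0 (w.2 i))) *
        ((∏ i, logDensity ρ a (w.1 i)) * ∏ i, logDensity ρ b (w.2 i)) := by
  have norm_hat_le (η : ℝ) : ‖hat φ η‖ ≤ 1 := hφ η ▸ norm_charFun_le_one (-η)
  funext w
  rw [integrand, symbol_eq_prod_log norm_hat_le ha hb hj hk, invFourier_prod
    (fun η => -Complex.log (1 - a * hat φ η)) fun ζ => -Complex.log (1 - b * hat φ ζ),
    statePhase_sum]
  simp only [logDensity, hφ]

theorem integrable_integrand {φ : ℝ → ℝ} (hac : (ρ : Measure ℝ) ≪ volume)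
    (hint : Integrable (charFun (ρ : Measure ℝ)))
    (hφ : ∀ η, hat φ η = charFun (ρ : Measure ℝ) (-η)) (ha : ‖a‖ < 1) (hb : ‖b‖ < 1) (hj : j ≠ 0)
    (hk : k ≠ 0) : Integrable (integrand φ a b α β j k) := by
  rw [integrand_eq_statePhase_mul hφ ha hb hj hk]
  exact (((hasMeasureSum_logSeries hac hint ha).coeff_pow j).prod
    ((hasMeasureSum_logSeries hac hint hb).coeff_pow k)).integrable_comp_mul
      (measurable_statePhase α β) (norm_statePhase_le_one α β)

end GeneratingSeries

end

end WalkMax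

theorem theorem1p12_general {Ω : Type*} [MeasurableSpace Ω] (μ : Measure Ω)
    (φ : ℝ → ℝ) (hφm : AEMeasurable φ) (hφ : ∀ x, 0 ≤ φ x) (hint : Integrable (WalkMax.hat φ))
    (X : ℕ → Ω → ℝ)
    (hlaw : ∀ i, HasLaw (X i) (volume.withDensity fun x => ENNReal.ofReal (φ x)) μ)
    (hindep : iIndepFun X μ)
    (a b : ℂ) (ha : ‖a‖ < 1) (hb : ‖b‖ < 1) (α β : ℝ) :
    (Summable fun pq : ℕ+ × ℕ+ =>
      a ^ (pq.1 : ℕ) * b ^ (pq.2 : ℕ) *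
        ∫ ω, Complex.exp (Complex.I * ((α * WalkMax.position X pq.1 ω
          + β * WalkMax.runningMax X (pq.1 + pq.2) ω : ℝ) : ℂ)) ∂μ) ∧
    (∀ (j : ℕ+) (η : Fin j → ℝ),
      (Summable fun m : ℕ => WalkMax.taylorCoeff (WalkMax.geom a) m *
        WalkMax.phiMonomial j m (fun i => WalkMax.hat φ (η i))) ∧
      (Summable fun m : ℕ => WalkMax.taylorCoeff (WalkMax.geom b) m *
        WalkMax.phiMonomial j m (fun i => WalkMax.hat φ (η i)))) ∧
    (∀ j k : ℕ+, Integrable (WalkMax.symbol φ a b j k) ∧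
      Integrable (WalkMax.integrand φ a b α β j k)) ∧
    HasSum
      (fun jk : ℕ+ × ℕ+ =>
        (1 / ((jk.1 : ℕ).factorial : ℂ)) * (1 / ((jk.2 : ℕ).factorial : ℂ)) *
          ∫ w, WalkMax.integrand φ a b α β jk.1 jk.2 w)
      (∑' pq : ℕ+ × ℕ+,
        a ^ (pq.1 : ℕ) * b ^ (pq.2 : ℕ) *
          ∫ ω, Complex.exp (Complex.I * ((α * WalkMax.position X pq.1 ω
            + β * WalkMax.runningMax X (pq.1 + pq.2) ω : ℝ) : ℂ)) ∂μ) := by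
  have := hindep.isProbabilityMeasure
  have := (hlaw 0).isProbabilityMeasure_iff.1 inferInstance
  let ρ : FiniteMeasure ℝ := ⟨volume.withDensity fun x => ENNReal.ofReal (φ x), inferInstance⟩
  have : IsProbabilityMeasure (ρ : Measure ℝ) := this
  have hat_eq (η : ℝ) : WalkMax.hat φ η = charFun (ρ : Measure ℝ) (-η) :=
    WalkMax.hat_eq_charFun hφm hφ η
  have norm_hat_le (η : ℝ) : ‖WalkMax.hat φ η‖ ≤ 1 := hat_eq η ▸ norm_charFun_le_one (-η)
  have integrable_charFun : Integrable (charFun (ρ : Measure ℝ)) := by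
    simpa only [hat_eq, neg_neg] using hint.comp_neg
  have hac : (ρ : Measure ℝ) ≪ volume := withDensity_absolutelyContinuous _ _
  obtain ⟨S, hR, hL⟩ := WalkMax.exists_hasSum_walk hac integrable_charFun hlaw hindep ha hb
    (WalkMax.measurable_statePhase α β) (WalkMax.norm_statePhase_le_one α β)
  simp only [WalkMax.statePhase_walkState] at hL
  have summable_phi {c : ℂ} (hc : ‖c‖ < 1) (j : ℕ+) (η : Fin j → ℝ) :=
    (WalkMax.hasSum_Phi_geom c j.ne_zero fun i =>
      WalkMax.norm_mul_lt_one hc (norm_hat_le (η i))).summable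
  refine ⟨hL.summable, fun j η => ⟨summable_phi ha j η, summable_phi hb j η⟩, fun j k =>
    ⟨WalkMax.integrable_symbol hint norm_hat_le ha hb j.ne_zero k.ne_zero,
      WalkMax.integrable_integrand hac integrable_charFun hat_eq ha hb j.ne_zero k.ne_zero⟩, ?_⟩
  rw [hL.tsum_eq]
  refine hR.congr_fun fun jk => ?_
  rw [WalkMax.integrand_eq_statePhase_mul hat_eq ha hb jk.1.ne_zero jk.2.ne_zero]

theorem theorem1p12 {Ω : Type*} [MeasurableSpace Ω] (μ : Measure Ω) [IsProbabilityMeasure μ]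
    (φ : 𝓢(ℝ, ℝ)) (hφ : ∀ x, 0 ≤ φ x)
    (X : ℕ → Ω → ℝ)
    (hlaw : ∀ i, HasLaw (X i) (volume.withDensity fun x => ENNReal.ofReal (φ x)) μ)
    (hindep : iIndepFun X μ)
    (a b : ℂ) (ha : ‖a‖ < 1) (hb : ‖b‖ < 1) (α β : ℝ) :
    -- the series on the left-hand side converges absolutely
    (Summable fun pq : ℕ+ × ℕ+ =>
      a ^ (pq.1 : ℕ) * b ^ (pq.2 : ℕ) *
        ∫ ω, Complex.exp (Complex.I * ((α * WalkMax.position X pq.1 ω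
          + β * WalkMax.runningMax X (pq.1 + pq.2) ω : ℝ) : ℂ)) ∂μ) ∧
    -- the series defining the `j`-maps converge at the values of `φ̂`
    (∀ (j : ℕ+) (η : Fin j → ℝ),
      (Summable fun m : ℕ => WalkMax.taylorCoeff (WalkMax.geom a) m *
        WalkMax.phiMonomial j m (fun i => WalkMax.hat φ (η i))) ∧
      (Summable fun m : ℕ => WalkMax.taylorCoeff (WalkMax.geom b) m *
        WalkMax.phiMonomial j m (fun i => WalkMax.hat φ (η i)))) ∧
    -- all integrals on the right-hand side converge absolutely
    (∀ j k : ℕ+, Integrable (WalkMax.symbol φ a b j k) ∧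
      Integrable (WalkMax.integrand φ a b α β j k)) ∧
    -- the series on the right-hand side converges absolutely to the left-hand side
    HasSum
      (fun jk : ℕ+ × ℕ+ =>
        (1 / ((jk.1 : ℕ).factorial : ℂ)) * (1 / ((jk.2 : ℕ).factorial : ℂ)) *
          ∫ w, WalkMax.integrand φ a b α β jk.1 jk.2 w)
      (∑' pq : ℕ+ × ℕ+,
        a ^ (pq.1 : ℕ) * b ^ (pq.2 : ℕ) *
          ∫ ω, Complex.exp (Complex.I * ((α * WalkMax.position X pq.1 ω
            + β * WalkMax.runningMax X (pq.1 + pq.2) ω : ℝ) : ℂ)) ∂μ) :=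
  theorem1p12_general μ φ φ.continuous.aemeasurable hφ (WalkMax.integrable_hat φ) X hlaw hindep
    a b ha hb α β
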